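/- Let $X$ be a smooth projective variety over $\mathbb{C}$. Let $\mathrm{Pic}^0(X)$ denote the set of (isomorphism classes of) algebraically trivial line bundles on $X$, i.e. line bundles algebraically equivalent to $\mathcal{O}_X$. A vector bundle $E$ of rank $n$ on $X$ is called algebraically globally generated if for every closed point $x\in X$ there are $n$ algebraically trivial line bundles $L_1,\dots,L_n$ on $X$ and global sections $s_i\in H^0(X,E\otimes L_i)$ such that, for non-vanishing local sections $s_i'$ of $L_i$ around $x$, the local sections $s_1/s_1',\dots,s_n/s_n'$ of $E$ generate the fibre $E(x)$ (this does not depend on the choice of the $s_i'$). For a line bundle $M$ on $X$, the para-canonical base locus is $\mathrm{PBs}|M|=\bigcap_{P\in\mathrm{Pic}^0(X)}\mathrm{Bs}|M\otimes P|$, where $\mathrm{Bs}|N|$ is the set of points of $X$ at which all global sections of the line bundle $N$ vanish. If a vector bundle $E$ of rank $n$ on $X$ is algebraically globally generated, then for every $r\ge 0$ the exterior power $\wedge^r E$, a vector bundle of rank $\binom{n}{r}$, is algebraically globally generated. In particular, $\mathrm{PBs}|\det E|=\varnothing$, where $\det E=\wedge^n E$. -/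

import Mathlib

open CategoryTheory AlgebraicGeometry Opposite TensorProduct

noncomputable section

namespace AlgGlobGen

/-! ### Exterior powers of modules along a change of rings -/

section Algebra

variable {A B M N : Type*} [CommRing A] [CommRing B] [AddCommGroup M] [AddCommGroup N]
  [Module A M] [Module B N] {σ : A →+* B}

/-- A `σ`-semilinear map `g : M → N` induces a `σ`-semilinear map `⋀^r_A M → ⋀^r_B N`,
determined by `m₁ ∧ ⋯ ∧ m_r ↦ g m₁ ∧ ⋯ ∧ g m_r` (see `extPowMap_ιMulti`). -/
def extPowMap (r : ℕ) (g : M →ₛₗ[σ] N) : ⋀[A]^r M →ₛₗ[σ] ⋀[B]^r N :=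
  letI : Module A (⋀[B]^r N) := Module.compHom _ σ
  let φ : M [⋀^Fin r]→ₗ[A] (⋀[B]^r N) :=
    { toFun := fun m => exteriorPower.ιMulti B r (fun i => g (m i))
      map_update_add' := by
        intro _ m i x y
        have h : ∀ z, (fun j => g (Function.update m i z j)) =
            Function.update (fun j => g (m j)) i (g z) := by
          intro z; funext j
          by_cases hj : j = i
          · subst hj; simp
          · simp [hj]
        rw [h, h, h, map_add, AlternatingMap.map_update_add]
      map_update_smul' := by
        intro _ m i c x
        have h : ∀ z, (fun j => g (Function.update m i z j)) =
            Function.update (fun j => g (m j)) i (g z) := by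
          intro z; funext j
          by_cases hj : j = i
          · subst hj; simp
          · simp [hj]
        rw [h, h, map_smulₛₗ, AlternatingMap.map_update_smul]
        rfl
      map_eq_zero_of_eq' := by
        intro m i j hm hij
        exact AlternatingMap.map_eq_zero_of_eq _ _ (by simp [hm]) hij }
  let ψ : ⋀[A]^r M →ₗ[A] ⋀[B]^r N := exteriorPower.alternatingMapLinearEquiv φ
  { toFun := ψ
    map_add' := map_add ψ
    map_smul' := fun c x => ψ.map_smul c x }

lemma extPowMap_ιMulti (r : ℕ) (g : M →ₛₗ[σ] N) (m : Fin r → M) :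
    extPowMap r g (exteriorPower.ιMulti A r m) = exteriorPower.ιMulti B r (fun i => g (m i)) := by
  let _ : Module A (⋀[B]^r N) := Module.compHom _ σ
  exact exteriorPower.alternatingMapLinearEquiv_apply_ιMulti _ _

/-- Induction on elements of `⋀^r M`. -/
lemma extPow_induction {r : ℕ} {P : ⋀[A]^r M → Prop}
    (h₀ : P 0) (hadd : ∀ x y, P x → P y → P (x + y)) (hsmul : ∀ (a : A) x, P x → P (a • x))
    (hmk : ∀ m : Fin r → M, P (exteriorPower.ιMulti A r m)) (x : ⋀[A]^r M) : P x := by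
  have hx : x ∈ Submodule.span A (Set.range (exteriorPower.ιMulti A r (M := M))) := by
    rw [exteriorPower.ιMulti_span]; trivial
  induction hx using Submodule.span_induction with
  | mem x h => obtain ⟨m, rfl⟩ := h; exact hmk m
  | zero => exact h₀
  | add x y _ _ hx hy => exact hadd x y hx hy
  | smul a x _ hx => exact hsmul a x hx

lemma extPowMap_id {σ : A →+* A} (r : ℕ) (g : M →ₛₗ[σ] M) (hσ : σ = RingHom.id A)
    (hg : ∀ m, g m = m) (x : ⋀[A]^r M) : extPowMap r g x = x := by
  subst hσ
  induction x using extPow_induction with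
  | h₀ => exact map_zero _
  | hadd x y hx hy => rw [map_add, hx, hy]
  | hsmul a x hx => rw [map_smulₛₗ, hx, RingHom.id_apply]
  | hmk m => simp only [extPowMap_ιMulti, hg]

lemma extPowMap_comp {C K : Type*} [CommRing C] [AddCommGroup K] [Module C K] {τ : B →+* C}
    {ρ : A →+* C} (r : ℕ) (g : M →ₛₗ[σ] N) (g' : N →ₛₗ[τ] K) (h : M →ₛₗ[ρ] K)
    (hρ : ρ = τ.comp σ) (hg : ∀ m, h m = g' (g m)) (x : ⋀[A]^r M) :
    extPowMap r h x = extPowMap r g' (extPowMap r g x) := by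
  subst hρ
  induction x using extPow_induction with
  | h₀ => simp only [map_zero]
  | hadd x y hx hy => rw [map_add, hx, hy, map_add, map_add]
  | hsmul a x hx => rw [map_smulₛₗ, hx, map_smulₛₗ, map_smulₛₗ, RingHom.comp_apply]
  | hmk m => simp only [extPowMap_ιMulti, hg]

end Algebra

/-! ### Sheaves of modules: tensor products and exterior powers -/

section Sheaves

variable {X : Scheme.{0}}

/-- The presheaf of `𝒪_X`-modules underlying a sheaf of `𝒪_X`-modules. -/
abbrev toPsh (M : X.Modules) : PresheafOfModules.{0} (X.presheaf ⋙ forget₂ CommRingCat RingCat) :=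
  (Scheme.Modules.toPresheafOfModules X).obj M

/-- The sheaf of `𝒪_X`-modules associated with a presheaf of `𝒪_X`-modules. -/
def sheafify (P : PresheafOfModules.{0} (X.presheaf ⋙ forget₂ CommRingCat RingCat)) : X.Modules :=
  (PresheafOfModules.sheafification (𝟙 X.ringCatSheaf.obj)).obj P

/-- The canonical map from the sections of a presheaf of modules to the sections of the associated
sheaf. -/
def toSheafifySection (P : PresheafOfModules.{0} (X.presheaf ⋙ forget₂ CommRingCat RingCat))
    (U : X.Opens) : P.obj (op U) → Γ(sheafify P, U) :=
  ((CategoryTheory.toSheafify (Opens.grothendieckTopology X) P.presheaf).app (op U)).hom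

/-- The tensor product `M ⊗ N` of sheaves of `𝒪_X`-modules: the sheaf associated with
`U ↦ M(U) ⊗ N(U)`. -/
def tensor (M N : X.Modules) : X.Modules :=
  sheafify (PresheafOfModules.Monoidal.tensorObj (toPsh M) (toPsh N))

/-- The section `m ⊗ n` of `M ⊗ N` over `U`. -/
def tmulSection {M N : X.Modules} {U : X.Opens} (m : Γ(M, U)) (n : Γ(N, U)) :
    Γ(tensor M N, U) :=
  toSheafifySection (PresheafOfModules.Monoidal.tensorObj (toPsh M) (toPsh N)) U
    (show TensorProduct Γ(X, U) Γ(M, U) Γ(N, U) from m ⊗ₜ n)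

/-- The restriction map of a presheaf of modules, with its semilinearity. -/
def resMap (P : PresheafOfModules.{0} (X.presheaf ⋙ forget₂ CommRingCat RingCat))
    {U V : X.Opensᵒᵖ} (i : U ⟶ V) :
    P.obj U →ₛₗ[(X.presheaf.map i).hom] P.obj V where
  toFun := P.map i
  map_add' := map_add (P.map i).hom
  map_smul' r m := P.map_smul i r m

/-- The presheaf `U ↦ ⋀^r_{𝒪(U)} P(U)`, with restriction maps
`m₁ ∧ ⋯ ∧ m_r ↦ m₁|_V ∧ ⋯ ∧ m_r|_V`. -/
def extPowPresheaf (r : ℕ)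
    (P : PresheafOfModules.{0} (X.presheaf ⋙ forget₂ CommRingCat RingCat)) :
    PresheafOfModules.{0} (X.presheaf ⋙ forget₂ CommRingCat RingCat) where
  obj U := ModuleCat.of (X.presheaf.obj U) (⋀[X.presheaf.obj U]^r (P.obj U))
  map {U V} i := ModuleCat.ofHom
    (Y := (ModuleCat.restrictScalars (X.presheaf.map i).hom).obj
      (ModuleCat.of (X.presheaf.obj V) (⋀[X.presheaf.obj V]^r (P.obj V))))
    { toFun := extPowMap r (resMap P i)
      map_add' := map_add _
      map_smul' := fun c x => map_smulₛₗ (extPowMap r (resMap P i)) c x }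
  map_id U := by
    refine ModuleCat.hom_ext (LinearMap.ext fun (x : ⋀[X.presheaf.obj U]^r (P.obj U)) => ?_)
    exact extPowMap_id r (resMap P (𝟙 U)) (by rw [X.presheaf.map_id]; rfl)
      (fun m => by change P.map (𝟙 U) m = m; rw [P.map_id]; rfl) x
  map_comp {U V W} f g := by
    refine ModuleCat.hom_ext (LinearMap.ext fun (x : ⋀[X.presheaf.obj U]^r (P.obj U)) => ?_)
    exact extPowMap_comp r (resMap P f) (resMap P g) (resMap P (f ≫ g))
      (by rw [X.presheaf.map_comp]; rfl) (fun m => P.map_comp_apply f g m) x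

/-- The exterior power `⋀^r M` of a sheaf of `𝒪_X`-modules: the sheaf associated with
`U ↦ ⋀^r M(U)`. -/
def extPow (r : ℕ) (M : X.Modules) : X.Modules :=
  sheafify (extPowPresheaf r (toPsh M))

/-- The structure sheaf as a module over itself. -/
def structureSheaf (X : Scheme.{0}) : X.Modules := SheafOfModules.unit X.ringCatSheaf

/-! ### Vector bundles, fibres, vanishing -/

/-- The restriction of a section to a smaller open subset. -/
def res (M : X.Modules) {U V : X.Opens} (h : V ≤ U) (s : Γ(M, U)) : Γ(M, V) :=
  M.presheaf.map (homOfLE h).op s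

/-- `e₁, …, e_n ∈ M(U)` is a frame of `M` over `U`: the morphism `𝒪_U^n → M|_U` defined by
the `e_i` is an isomorphism, i.e. bijective on sections over each open `V ⊆ U`. -/
def IsFrame {ι : Type} [Fintype ι] (M : X.Modules) (U : X.Opens) (e : ι → Γ(M, U)) : Prop :=
  ∀ (V : X.Opens) (h : V ≤ U),
    Function.Bijective (fun c : ι → Γ(X, V) => ∑ i, c i • res M h (e i))

/-- `M` is a vector bundle of rank `n`: a sheaf of modules locally isomorphic to `𝒪^n`. -/
def IsVectorBundle (n : ℕ) (M : X.Modules) : Prop :=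
  ∀ x : X, ∃ U : X.Opens, x ∈ U ∧ ∃ e : Fin n → Γ(M, U), IsFrame M U e

/-- A line bundle is a vector bundle of rank one. -/
def IsLineBundle (L : X.Modules) : Prop := IsVectorBundle 1 L

/-- A section `s` of a line bundle over `U` is non-vanishing if it trivializes the line bundle,
i.e. `𝒪_U → L|_U`, `1 ↦ s`, is an isomorphism. -/
def IsNonvanishing (L : X.Modules) (U : X.Opens) (s : Γ(L, U)) : Prop :=
  IsFrame L U (fun _ : Unit => s)

/-- The stalk `M_x`, with its structure of `𝒪_{X,x}`-module. -/
abbrev Stalk (M : X.Modules) (x : X) : Type :=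
  ((TopCat.Presheaf.stalk (toPsh M).presheaf x : Ab) : Type)

/-- The fibre `M(x) = κ(x) ⊗ M_x`, a vector space over the residue field `κ(x)`. -/
abbrev Fibre (M : X.Modules) (x : X) : Type :=
  TensorProduct (X.presheaf.stalk x) (IsLocalRing.ResidueField (X.presheaf.stalk x)) (Stalk M x)

/-- The value `s(x) ∈ M(x)` of a section `s ∈ M(U)` at a point `x ∈ U`. -/
def value (M : X.Modules) {U : X.Opens} (x : X) (hx : x ∈ U) (s : Γ(M, U)) : Fibre M x :=
  1 ⊗ₜ (show Stalk M x from TopCat.Presheaf.germ (toPsh M).presheaf U x hx s)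

end Sheaves

/-! ### Algebraically trivial line bundles -/

section Pic

variable {X : Scheme.{0}}

/-- The point `Spec ℂ`. -/
abbrev pt : Scheme.{0} := Spec (.of ℂ)

/-- For a `ℂ`-scheme `T` with a `ℂ`-point `t`, the inclusion `X = X × {t} ⟶ X × T`. -/
def sliceMap (f : X ⟶ pt) {T : Scheme.{0}} (g : T ⟶ pt) (t : pt ⟶ T) (ht : t ≫ g = 𝟙 pt) :
    X ⟶ Limits.pullback f g :=
  Limits.pullback.lift (𝟙 X) (f ≫ t) (by simp [ht])

/-- `L` and `N` are two members of one algebraic family of line bundles on the `ℂ`-scheme `X`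
with connected base: there are a connected `ℂ`-scheme `T` of finite type, a line bundle on `X × T`
and `ℂ`-points `t₀`, `t₁` of `T` such that the restrictions of this line bundle to `X × {t₀}` and
`X × {t₁}` are isomorphic to `L` and `N`. -/
def InFamily (f : X ⟶ pt) (L N : X.Modules) : Prop :=
  ∃ (T : Scheme.{0}) (g : T ⟶ pt) (t₀ t₁ : pt ⟶ T) (h₀ : t₀ ≫ g = 𝟙 pt) (h₁ : t₁ ≫ g = 𝟙 pt)
    (F : (Limits.pullback f g).Modules),
    ConnectedSpace T ∧ LocallyOfFiniteType g ∧ QuasiCompact g ∧ IsLineBundle F ∧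
    Nonempty ((Scheme.Modules.pullback (sliceMap f g t₀ h₀)).obj F ≅ L) ∧
    Nonempty ((Scheme.Modules.pullback (sliceMap f g t₁ h₁)).obj F ≅ N)

/-- Algebraic equivalence of line bundles: `L` and `N` are joined by a finite chain of
algebraic families with connected bases. -/
def AlgEquivalent (f : X ⟶ pt) : X.Modules → X.Modules → Prop :=
  Relation.TransGen (InFamily f)

/-- `L` is an algebraically trivial line bundle, i.e. its class lies in `Pic⁰(X)`: it is
algebraically equivalent to `𝒪_X`. -/
def IsAlgTrivial (f : X ⟶ pt) (L : X.Modules) : Prop :=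
  IsLineBundle L ∧ AlgEquivalent f L (structureSheaf X)

/-! ### Algebraic global generation and the para-canonical base locus -/

/-- The sheaf `E` on `X` is a vector bundle of rank `n` which is algebraically globally generated:
for each closed point `x` there are `n` algebraically trivial line bundles `L_i` and global sections
`s_i` of `E ⊗ L_i` such that, for non-vanishing local sections `s'_i` of `L_i` around `x`, the local
sections `e_i = s_i / s'_i` of `E` (so `e_i ⊗ s'_i = s_i`) generate the fibre `E(x)`. -/
def IsAlgGloballyGenerated (f : X ⟶ pt) (n : ℕ) (E : X.Modules) : Prop :=
  IsVectorBundle n E ∧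
  ∀ x : X, IsClosed ({x} : Set X) →
    ∃ (L : Fin n → X.Modules) (s : ∀ i, Γ(tensor E (L i), ⊤)),
      (∀ i, IsAlgTrivial f (L i)) ∧
      ∃ (U : X.Opens) (hx : x ∈ U) (s' : ∀ i, Γ(L i, U)) (e : Fin n → Γ(E, U)),
        (∀ i, IsNonvanishing (L i) U (s' i)) ∧
        (∀ i, tmulSection (e i) (s' i) = res (tensor E (L i)) le_top (s i)) ∧
        Submodule.span (IsLocalRing.ResidueField (X.presheaf.stalk x))
          (Set.range fun i => value E x hx (e i)) = ⊤

/-- The base locus `Bs|L|`: the points at which all global sections of `L` vanish. -/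
def baseLocus (L : X.Modules) : Set X :=
  {x | ∀ s : Γ(L, ⊤), value L x (U := ⊤) trivial s = 0}

/-- The para-canonical base locus `PBs|L|`: the intersection of the base loci `Bs|L ⊗ P|` over all
algebraically trivial line bundles `P`. -/
def paraBaseLocus (f : X ⟶ pt) (L : X.Modules) : Set X :=
  {x | ∀ P : X.Modules, IsAlgTrivial f P → x ∈ baseLocus (tensor L P)}

/-- The determinant of a vector bundle of rank `n`. -/
abbrev det (n : ℕ) (E : X.Modules) : X.Modules := extPow n E

/-! ### Smooth projective varieties -/

attribute [local instance] MvPolynomial.gradedAlgebra in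
/-- The projective space `ℙ^N` over `ℂ`. -/
def projSpace (N : ℕ) : Scheme.{0} :=
  Proj (MvPolynomial.homogeneousSubmodule (Fin (N + 1)) ℂ)

attribute [local instance] MvPolynomial.gradedAlgebra in
/-- The structure morphism of `ℙ^N`. -/
def projSpaceStr (N : ℕ) : projSpace N ⟶ pt :=
  Proj.toSpecZero (MvPolynomial.homogeneousSubmodule (Fin (N + 1)) ℂ) ≫
    Spec.map (CommRingCat.ofHom
      (algebraMap ℂ (MvPolynomial.homogeneousSubmodule (Fin (N + 1)) ℂ 0)))

/-- `X` is a smooth projective variety over `ℂ`: it is integral, smooth over `ℂ`, and admits a closed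
immersion over `ℂ` into some `ℙ^N`. -/
structure IsSmoothProjectiveVariety (f : X ⟶ pt) : Prop where
  integral : IsIntegral X
  smooth : Smooth f
  projective : ∃ (N : ℕ) (i : X ⟶ projSpace N), IsClosedImmersion i ∧ i ≫ projSpaceStr N = f

end Pic

end AlgGlobGen

end

/-! Let `e_i = s_i / s'_i` generate `E(x)`. For each `r`-element subset `S` of the indices, the
`s_i` with `i ∈ S` have a wedge product: a global section of `⋀^r E ⊗ ⨂_{i ∈ S} L_i` whose quotient
by `⨂ s'_i` is the wedge of the `e_i`. By Nakayama the `e_i` form a frame near `x`, so these wedges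
form a frame of `⋀^r E` there and span its fibre at `x`.

Three points need proof. The global wedge exists (`exists_wedge_section`): locally `s_i = a_i ⊗ t_i`
with `t_i` non-vanishing, and replacing `t_i` by `c_i t_i` divides `a_i` by `c_i`, so `(⋀ a_i) ⊗ (⨂
t_i)` does not change and the local products glue. The twists `⨂ L_i` are algebraically trivial
(`IsAlgTrivial.tensor`): a family of line bundles on `X × T` may be tensored with the pullback of a
fixed line bundle from `X`. This requires pullback to commute with tensor products of line bundles,
which rests on `IsNonvanishing.pb`. Finally, generation of the fibre spreads to a frame
(`IsVectorBundle.exists_isFrame`).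

For the determinant, `r = n` gives a rank one bundle. Generation is known at closed points only,
whereas the base locus contains all scheme points; since `X` is Jacobson, every point specializes to
a closed one, and non-vanishing is open. -/

open CategoryTheory AlgebraicGeometry Opposite TensorProduct

noncomputable section

namespace AlgGlobGen

/-! ### Restriction, gluing, and sections of an associated sheaf. -/

section LocalSections

variable {X : Scheme.{0}}

/-- Presheaves of modules over the structure presheaf of `X`. -/
abbrev PModules (X : Scheme.{0}) : Type 1 :=
  PresheafOfModules.{0} (X.presheaf ⋙ forget₂ CommRingCat RingCat)

/-- The restriction of functions to a smaller open subset. -/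
abbrev fres {U V : X.Opens} (h : V ≤ U) : Γ(X, U) →+* Γ(X, V) :=
  (X.presheaf.map (homOfLE h).op).hom

/-- The restriction of a section of a presheaf of modules to a smaller open subset. -/
def pres (P : PModules X) {U V : X.Opens} (h : V ≤ U) : P.obj (op U) →ₛₗ[fres h] P.obj (op V) :=
  resMap P (homOfLE h).op

lemma fres_fres {U V W : X.Opens} (h : V ≤ U) (h' : W ≤ V) (a : Γ(X, U)) :
    fres h' (fres h a) = fres (h'.trans h) a := by
  simp only [fres, ← CommRingCat.comp_apply, ← X.presheaf.map_comp]; rfl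

@[simp] lemma fres_self {U : X.Opens} (h : U ≤ U) (a : Γ(X, U)) : fres h a = a := by
  simp [fres]

lemma pres_pres (P : PModules X) {U V W : X.Opens} (h : V ≤ U) (h' : W ≤ V) (s : P.obj (op U)) :
    pres P h' (pres P h s) = pres P (h'.trans h) s :=
  (P.map_comp_apply (homOfLE h).op (homOfLE h').op s).symm

@[simp] lemma pres_self (P : PModules X) {U : X.Opens} (h : U ≤ U) (s : P.obj (op U)) :
    pres P h s = s := by
  change P.map (𝟙 (op U)) s = s
  rw [P.map_id]; rfl

lemma res_res (M : X.Modules) {U V W : X.Opens} (h : V ≤ U) (h' : W ≤ V) (s : Γ(M, U)) :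
    res M h' (res M h s) = res M (h'.trans h) s := pres_pres (toPsh M) h h' s

@[simp] lemma res_self (M : X.Modules) {U : X.Opens} (h : U ≤ U) (s : Γ(M, U)) :
    res M h s = s := pres_self (toPsh M) h s

lemma res_smul (M : X.Modules) {U V : X.Opens} (h : V ≤ U) (a : Γ(X, U)) (s : Γ(M, U)) :
    res M h (a • s) = fres h a • res M h s := map_smulₛₗ (pres (toPsh M) h) a s

lemma res_add (M : X.Modules) {U V : X.Opens} (h : V ≤ U) (s t : Γ(M, U)) :
    res M h (s + t) = res M h s + res M h t := map_add (pres (toPsh M) h) s t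

lemma res_zero (M : X.Modules) {U V : X.Opens} (h : V ≤ U) :
    res M h (0 : Γ(M, U)) = 0 := map_zero (pres (toPsh M) h)

lemma res_sum (M : X.Modules) {U V : X.Opens} (h : V ≤ U) {ι : Type*} (s : Finset ι)
    (f : ι → Γ(M, U)) : res M h (∑ i ∈ s, f i) = ∑ i ∈ s, res M h (f i) :=
  map_sum (pres (toPsh M) h) f s

lemma mem_iInf_opens {ι : Type*} [Finite ι] {U : ι → X.Opens} {x : X} :
    x ∈ ⨅ i, U i ↔ ∀ i, x ∈ U i := by
  rw [← SetLike.mem_coe, TopologicalSpace.Opens.coe_iInf, Set.mem_iInter]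
  rfl

lemma eq_of_locally_eq (M : X.Modules) {U : X.Opens} (s t : Γ(M, U))
    (H : ∀ x ∈ U, ∃ (V : X.Opens) (h : V ≤ U), x ∈ V ∧ res M h s = res M h t) : s = t := by
  choose! V hV hx hst using H
  refine TopCat.Sheaf.eq_of_locally_eq' ⟨M.presheaf, M.isSheaf⟩ (fun x : U => V x) U
    (fun x => homOfLE (hV x x.2)) (fun x hxU => ?_) s t (fun x => hst x x.2)
  exact TopologicalSpace.Opens.mem_iSup.2 ⟨⟨x, hxU⟩, hx x hxU⟩

lemma exists_glue (M : X.Modules) {ι : Type*} {U : X.Opens} (V : ι → X.Opens) (hV : ∀ i, V i ≤ U)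
    (hU : ∀ x ∈ U, ∃ i, x ∈ V i) (s : ∀ i, Γ(M, V i))
    (H : ∀ i j (W : X.Opens) (hi : W ≤ V i) (hj : W ≤ V j), res M hi (s i) = res M hj (s j)) :
    ∃ t : Γ(M, U), ∀ i, res M (hV i) t = s i :=
  (TopCat.Sheaf.existsUnique_gluing' ⟨M.presheaf, M.isSheaf⟩ V U (fun i => homOfLE (hV i))
    (fun x hx => TopologicalSpace.Opens.mem_iSup.2 (hU x hx)) s
    (fun i j => H i j _ inf_le_left inf_le_right)).exists

lemma feq_of_locally_eq {U : X.Opens} (s t : Γ(X, U))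
    (H : ∀ x ∈ U, ∃ (V : X.Opens) (h : V ≤ U), x ∈ V ∧ fres h s = fres h t) : s = t :=
  eq_of_locally_eq (structureSheaf X) s t H

lemma fexists_glue {ι : Type*} {U : X.Opens} (V : ι → X.Opens) (hV : ∀ i, V i ≤ U)
    (hU : ∀ x ∈ U, ∃ i, x ∈ V i) (s : ∀ i, Γ(X, V i))
    (H : ∀ i j (W : X.Opens) (hi : W ≤ V i) (hj : W ≤ V j), fres hi (s i) = fres hj (s j)) :
    ∃ t : Γ(X, U), ∀ i, fres (hV i) t = s i :=
  exists_glue (structureSheaf X) V hV hU s H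

/-! ### Sections of the associated sheaf -/

/-- The canonical map from sections of a presheaf of modules to sections of its associated sheaf,
as a linear map. -/
def tsh (P : PModules X) (U : X.Opens) : P.obj (op U) →ₗ[Γ(X, U)] Γ(sheafify P, U) :=
  (((PresheafOfModules.sheafificationAdjunction (𝟙 X.ringCatSheaf.obj)).unit.app P).app (op U)).hom

lemma res_tsh (P : PModules X) {U V : X.Opens} (h : V ≤ U) (p : P.obj (op U)) :
    res (sheafify P) h (tsh P U p) = tsh P V (pres P h p) :=
  (PresheafOfModules.naturality_apply
    ((PresheafOfModules.sheafificationAdjunction (𝟙 X.ringCatSheaf.obj)).unit.app P)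
    (homOfLE h).op p).symm

/-- Sheafification is locally injective; with the local surjectivity in `exists_locally_tsh_eq`,
this is all that is used about sections of the tensor and exterior power sheaves. -/
lemma locally_eq_of_tsh_eq (P : PModules X) {U : X.Opens} (p q : P.obj (op U))
    (H : tsh P U p = tsh P U q) (x : X) (hx : x ∈ U) :
    ∃ (V : X.Opens) (h : V ≤ U), x ∈ V ∧ pres P h p = pres P h q := by
  have := Presheaf.equalizerSieve_mem (Opens.grothendieckTopology X)
    (CategoryTheory.toSheafify (Opens.grothendieckTopology X) P.presheaf) (X := op U) p q H
  obtain ⟨V, i, hi, hxV⟩ := this x hx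
  exact ⟨V, i.le, hxV, hi⟩

lemma exists_locally_tsh_eq (P : PModules X) {U : X.Opens} (s : Γ(sheafify P, U))
    (x : X) (hx : x ∈ U) :
    ∃ (V : X.Opens) (h : V ≤ U) (p : P.obj (op V)), x ∈ V ∧ tsh P V p = res _ h s := by
  have := Presheaf.imageSieve_mem (Opens.grothendieckTopology X)
    (CategoryTheory.toSheafify (Opens.grothendieckTopology X) P.presheaf) (U := op U) s
  obtain ⟨V, i, ⟨p, hp⟩, hxV⟩ := this x hx
  exact ⟨V, i.le, p, hxV, hp⟩

end LocalSections

/-! ### Frames of presheaves and sheaves of modules. -/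

section Frames

variable {X : Scheme.{0}} {ι κ : Type} [Fintype ι] [Fintype κ]

/-- The analogue of `IsFrame` for presheaves of modules. -/
def IsPFrame (P : PModules X) (U : X.Opens) (e : ι → P.obj (op U)) : Prop :=
  ∀ (V : X.Opens) (h : V ≤ U),
    Function.Bijective (fun c : ι → Γ(X, V) => ∑ i, c i • pres P h (e i))

/-- The basis of sections over a smaller open subset given by a frame. -/
def IsPFrame.basis {P : PModules X} {U : X.Opens} {e : ι → P.obj (op U)} (he : IsPFrame P U e)
    {V : X.Opens} (h : V ≤ U) : Module.Basis ι Γ(X, V) (P.obj (op V)) :=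
  .ofEquivFun (LinearEquiv.ofBijective (Fintype.linearCombination Γ(X, V)
    (fun i => pres P h (e i))) (he V h)).symm

lemma IsPFrame.basis_apply {P : PModules X} {U : X.Opens} {e : ι → P.obj (op U)}
    (he : IsPFrame P U e) {V : X.Opens} (h : V ≤ U) (i : ι) :
    he.basis h i = pres P h (e i) := by
  classical
  simp only [IsPFrame.basis, Module.Basis.coe_ofEquivFun, LinearEquiv.symm_symm]
  change Fintype.linearCombination Γ(X, V) _ (Pi.single i 1) = _
  rw [Fintype.linearCombination_apply_single, one_smul]

lemma IsPFrame.of_basis {P : PModules X} {U : X.Opens} {e : ι → P.obj (op U)}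
    (H : ∀ (V : X.Opens) (h : V ≤ U), ∃ b : Module.Basis ι Γ(X, V) (P.obj (op V)),
      ∀ i, b i = pres P h (e i)) : IsPFrame P U e := by
  intro V h
  obtain ⟨b, hb⟩ := H V h
  convert b.equivFun.symm.bijective using 1
  ext c
  simp [Module.Basis.equivFun_symm_apply, hb]

lemma IsPFrame.pres {P : PModules X} {U : X.Opens} {e : ι → P.obj (op U)}
    (he : IsPFrame P U e) {V : X.Opens} (h : V ≤ U) :
    IsPFrame P V (fun i => pres P h (e i)) := by
  intro W hW
  simpa only [pres_pres] using he W (hW.trans h)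

lemma IsPFrame.reindex {P : PModules X} {U : X.Opens} {e : ι → P.obj (op U)}
    (he : IsPFrame P U e) (σ : κ ≃ ι) : IsPFrame P U (e ∘ σ) :=
  .of_basis fun V h => ⟨(he.basis h).reindex σ.symm, fun i => by simp [IsPFrame.basis_apply]⟩

/-- Coefficients are unique because they are unique locally. A section of the sheaf comes locally
from the presheaf, hence has local coefficients, and uniqueness lets them glue. Frames of tensor and
exterior powers thus reduce to bases of modules. -/
lemma IsPFrame.tsh {P : PModules X} {U : X.Opens} {e : ι → P.obj (op U)}
    (he : IsPFrame P U e) : IsFrame (sheafify P) U (fun i => tsh P U (e i)) := by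
  have key : ∀ (V : X.Opens) (h : V ≤ U) (c : ι → Γ(X, V)),
      ∑ i, c i • res (sheafify P) h (AlgGlobGen.tsh P U (e i)) =
        AlgGlobGen.tsh P V (∑ i, c i • AlgGlobGen.pres P h (e i)) := by
    intro V h c
    simp only [map_sum, map_smul, res_tsh]
  have inj : ∀ (V : X.Opens) (h : V ≤ U), Function.Injective
      (fun c : ι → Γ(X, V) => ∑ i, c i • res (sheafify P) h (AlgGlobGen.tsh P U (e i))) := by
    intro V h c d hcd
    simp only [key] at hcd
    funext i
    refine feq_of_locally_eq _ _ fun x hx => ?_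
    obtain ⟨W, hW, hxW, H⟩ := locally_eq_of_tsh_eq P _ _ hcd x hx
    refine ⟨W, hW, hxW, ?_⟩
    simp only [map_sum, map_smulₛₗ, pres_pres] at H
    exact congr_fun ((he W (hW.trans h)).injective H) i
  intro V h
  refine ⟨inj V h, fun s => ?_⟩
  choose! W hW p hxW hp using exists_locally_tsh_eq P s
  choose! c hc using fun x (hx : x ∈ V) => (he (W x) ((hW x hx).trans h)).surjective (p x)
  have hcs : ∀ (x : X) (hx : x ∈ V), ∑ i, c x i • res (sheafify P) ((hW x hx).trans h)
      (AlgGlobGen.tsh P U (e i)) = res _ (hW x hx) s := by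
    intro x hx
    rw [key, ← hp x hx]
    exact congrArg _ (hc x hx)
  have glue : ∀ i, ∃ t : Γ(X, V), ∀ x : V, fres (hW x x.2) t = c x i := by
    intro i
    refine fexists_glue (fun x : V => W x) (fun x => hW x x.2)
      (fun x hx => ⟨⟨x, hx⟩, hxW x hx⟩) _ ?_
    -- On an overlap both coefficient families express the restriction of the same section `s`, so
    -- injectivity over `Z` identifies them.
    intro x y Z hx hy
    refine congr_fun (inj Z ((hx.trans (hW x x.2)).trans h)
      (a₁ := fun i => fres hx (c x i)) (a₂ := fun i => fres hy (c y i)) ?_) i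
    have h1 := congrArg (res _ hx) (hcs x x.2)
    have h2 := congrArg (res _ hy) (hcs y y.2)
    simp only [res_sum, res_smul, res_res] at h1 h2
    exact h1.trans h2.symm
  choose t ht using glue
  refine ⟨t, eq_of_locally_eq _ _ _ fun x hx => ⟨W x, hW x hx, hxW x hx, ?_⟩⟩
  rw [← hcs x hx]
  simp only [res_sum, res_smul, res_res]
  exact Finset.sum_congr rfl fun i _ => by rw [ht i ⟨x, hx⟩]

lemma IsFrame.res {M : X.Modules} {U : X.Opens} {e : ι → Γ(M, U)}
    (he : IsFrame M U e) {V : X.Opens} (h : V ≤ U) :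
    IsFrame M V (fun i => res M h (e i)) := IsPFrame.pres (P := toPsh M) he h

lemma IsFrame.reindex {M : X.Modules} {U : X.Opens} {e : ι → Γ(M, U)}
    (he : IsFrame M U e) (σ : κ ≃ ι) : IsFrame M U (e ∘ σ) :=
  IsPFrame.reindex (P := toPsh M) he σ

lemma IsFrame.exists_sum {M : X.Modules} {U : X.Opens} {e : ι → Γ(M, U)}
    (he : IsFrame M U e) (s : Γ(M, U)) : ∃ c : ι → Γ(X, U), ∑ i, c i • e i = s := by
  obtain ⟨c, hc⟩ := (he U le_rfl).surjective s
  exact ⟨c, by simpa using hc⟩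

lemma IsFrame.inj {M : X.Modules} {U : X.Opens} {e : ι → Γ(M, U)}
    (he : IsFrame M U e) {c d : ι → Γ(X, U)} (h : ∑ i, c i • e i = ∑ i, d i • e i) : c = d :=
  (he U le_rfl).injective (by simpa using h)

lemma isFrame_one (U : X.Opens) :
    IsFrame (structureSheaf X) U (fun _ : Unit => (1 : Γ(X, U))) := by
  intro V h
  have h1 : AlgGlobGen.res (structureSheaf X) h (1 : Γ(X, U)) = (1 : Γ(X, V)) := map_one (fres h)
  have : (fun c : Unit → Γ(X, V) => ∑ i, c i • AlgGlobGen.res (structureSheaf X) h (1 : Γ(X, U))) =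
      fun c => (c () : Γ(X, V)) := by
    funext c
    rw [h1, Finset.univ_unique, Finset.sum_singleton]
    exact mul_one (c ())
  rw [this]
  exact (Equiv.funUnique Unit Γ(X, V)).bijective

/-! ### Tensor products -/

/-- Simple tensors in the tensor product presheaf. -/
def ptmul {P Q : PModules X} {U : X.Opens} (p : P.obj (op U)) (q : Q.obj (op U)) :
    (PresheafOfModules.Monoidal.tensorObj P Q).obj (op U) :=
  show TensorProduct Γ(X, U) (P.obj (op U)) (Q.obj (op U)) from p ⊗ₜ q

lemma res_tmulSection {M N : X.Modules} {U V : X.Opens} (h : V ≤ U) (m : Γ(M, U)) (n : Γ(N, U)) :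
    res (tensor M N) h (tmulSection m n) = tmulSection (res M h m) (res N h n) :=
  res_tsh (PresheafOfModules.Monoidal.tensorObj (toPsh M) (toPsh N)) h _

/-- The map `(m, n) ↦ m ⊗ n` on sections, as a bilinear map. -/
def tmulBilin (M N : X.Modules) (U : X.Opens) :
    Γ(M, U) →ₗ[Γ(X, U)] Γ(N, U) →ₗ[Γ(X, U)] Γ(tensor M N, U) :=
  (TensorProduct.mk Γ(X, U) Γ(M, U) Γ(N, U)).compr₂
    (tsh (PresheafOfModules.Monoidal.tensorObj (toPsh M) (toPsh N)) U)

lemma tmulBilin_apply {M N : X.Modules} {U : X.Opens} (m : Γ(M, U)) (n : Γ(N, U)) :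
    tmulBilin M N U m n = tmulSection m n := rfl

lemma smul_tmulSection {M N : X.Modules} {U : X.Opens} (a : Γ(X, U)) (m : Γ(M, U))
    (n : Γ(N, U)) : tmulSection (a • m) n = a • tmulSection m n := by
  simp only [← tmulBilin_apply, map_smul, LinearMap.smul_apply]

lemma tmulSection_smul {M N : X.Modules} {U : X.Opens} (a : Γ(X, U)) (m : Γ(M, U))
    (n : Γ(N, U)) : tmulSection m (a • n) = a • tmulSection m n := by
  simp only [← tmulBilin_apply, map_smul]

lemma sum_tmulSection {M N : X.Modules} {U : X.Opens} (m : ι → Γ(M, U))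
    (n : Γ(N, U)) : tmulSection (∑ i, m i) n = ∑ i, tmulSection (m i) n := by
  simp only [← tmulBilin_apply, map_sum, LinearMap.sum_apply]

lemma IsPFrame.ptmul {P Q : PModules X} {U : X.Opens} {e : ι → P.obj (op U)}
    {f : κ → Q.obj (op U)} (he : IsPFrame P U e) (hf : IsPFrame Q U f) :
    IsPFrame (PresheafOfModules.Monoidal.tensorObj P Q) U
      (fun i : ι × κ => AlgGlobGen.ptmul (e i.1) (f i.2)) := by
  refine .of_basis fun V h => ⟨Module.Basis.tensorProduct (R := Γ(X, V)) (S := Γ(X, V))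
    (he.basis h) (hf.basis h), fun i => ?_⟩
  refine (Module.Basis.tensorProduct_apply (R := Γ(X, V)) (S := Γ(X, V))
    (he.basis h) (hf.basis h) i.1 i.2).trans ?_
  rw [he.basis_apply, hf.basis_apply]
  rfl

lemma IsFrame.tmul {M N : X.Modules} {U : X.Opens} {e : ι → Γ(M, U)} {f : κ → Γ(N, U)}
    (he : IsFrame M U e) (hf : IsFrame N U f) :
    IsFrame (tensor M N) U (fun i : ι × κ => tmulSection (e i.1) (f i.2)) :=
  (IsPFrame.ptmul (P := toPsh M) (Q := toPsh N) he hf).tsh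

lemma IsFrame.tmul_nonvanishing {M N : X.Modules} {U : X.Opens} {e : ι → Γ(M, U)} {f : Γ(N, U)}
    (he : IsFrame M U e) (hf : IsNonvanishing N U f) :
    IsFrame (tensor M N) U (fun i => tmulSection (e i) f) :=
  (he.tmul hf).reindex (Equiv.prodPUnit ι).symm

lemma IsNonvanishing.tmul {M N : X.Modules} {U : X.Opens} {e : Γ(M, U)} {f : Γ(N, U)}
    (he : IsNonvanishing M U e) (hf : IsNonvanishing N U f) :
    IsNonvanishing (tensor M N) U (tmulSection e f) :=
  IsFrame.tmul_nonvanishing he hf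

lemma IsNonvanishing.res {L : X.Modules} {U : X.Opens} {e : Γ(L, U)}
    (he : IsNonvanishing L U e) {V : X.Opens} (h : V ≤ U) : IsNonvanishing L V (res L h e) :=
  IsFrame.res he h

lemma IsLineBundle.exists_nonvanishing {L : X.Modules} (hL : IsLineBundle L) (x : X) :
    ∃ (U : X.Opens) (s : Γ(L, U)), x ∈ U ∧ IsNonvanishing L U s := by
  obtain ⟨U, hx, e, he⟩ := hL x
  exact ⟨U, e 0, hx, he.reindex (Equiv.ofUnique Unit (Fin 1))⟩

lemma isLineBundle_of_exists {L : X.Modules}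
    (H : ∀ x, ∃ (U : X.Opens) (s : Γ(L, U)), x ∈ U ∧ IsNonvanishing L U s) : IsLineBundle L := by
  intro x
  obtain ⟨U, s, hx, hs⟩ := H x
  exact ⟨U, hx, _, IsFrame.reindex hs (Equiv.ofUnique (Fin 1) Unit)⟩

lemma isLineBundle_structureSheaf : IsLineBundle (structureSheaf X) :=
  isLineBundle_of_exists fun _ => ⟨⊤, _, trivial, isFrame_one ⊤⟩

lemma IsLineBundle.tensor {L N : X.Modules} (hL : IsLineBundle L) (hN : IsLineBundle N) :
    IsLineBundle (tensor L N) := by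
  refine isLineBundle_of_exists fun x => ?_
  obtain ⟨U, s, hU, hs⟩ := hL.exists_nonvanishing x
  obtain ⟨V, t, hV, ht⟩ := hN.exists_nonvanishing x
  exact ⟨U ⊓ V, _, ⟨hU, hV⟩, (hs.res inf_le_left).tmul (ht.res inf_le_right)⟩

/-! ### Exterior powers -/

/-- The section `m₁ ∧ ⋯ ∧ m_r` of `⋀^r M`. -/
def wedge {M : X.Modules} {U : X.Opens} {r : ℕ} (m : Fin r → Γ(M, U)) : Γ(extPow r M, U) :=
  tsh (extPowPresheaf r (toPsh M)) U (exteriorPower.ιMulti Γ(X, U) r m)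

lemma pres_ιMulti {P : PModules X} {U V : X.Opens} (h : V ≤ U) {r : ℕ}
    (m : Fin r → P.obj (op U)) :
    pres (extPowPresheaf r P) h (exteriorPower.ιMulti Γ(X, U) r m) =
      exteriorPower.ιMulti Γ(X, V) r (fun i => pres P h (m i)) :=
  extPowMap_ιMulti r (resMap P (homOfLE h).op) m

lemma res_wedge {M : X.Modules} {U V : X.Opens} (h : V ≤ U) {r : ℕ} (m : Fin r → Γ(M, U)) :
    res (extPow r M) h (wedge m) = wedge (fun i => res M h (m i)) :=
  (res_tsh (extPowPresheaf r (toPsh M)) h _).trans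
    (congrArg _ (pres_ιMulti (P := toPsh M) h m))

lemma wedge_smul {M : X.Modules} {U : X.Opens} {r : ℕ} (c : Fin r → Γ(X, U))
    (m : Fin r → Γ(M, U)) : wedge (fun i => c i • m i) = (∏ i, c i) • wedge m :=
  (congrArg _ ((exteriorPower.ιMulti Γ(X, U) r (M := Γ(M, U))).toMultilinearMap.map_smul_univ c m)).trans
    (map_smul (tsh (extPowPresheaf r (toPsh M)) U) _ _)

lemma IsPFrame.ιMulti {P : PModules X} {U : X.Opens} {n : ℕ} {e : Fin n → P.obj (op U)}
    (he : IsPFrame P U e) (r : ℕ) :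
    IsPFrame (extPowPresheaf r P) U (fun s : Set.powersetCard (Fin n) r =>
      exteriorPower.ιMulti Γ(X, U) r (fun j => e (Set.powersetCard.ofFinEmbEquiv.symm s j))) := by
  refine .of_basis fun V h => ⟨(he.basis h).exteriorPower r, fun s => ?_⟩
  refine (exteriorPower.basis_apply _ _ (he.basis h) s).trans ?_
  refine Eq.trans ?_ (pres_ιMulti h _).symm
  refine congrArg (exteriorPower.ιMulti Γ(X, V) r) ?_
  funext j
  exact he.basis_apply h _

lemma IsFrame.wedge {M : X.Modules} {U : X.Opens} {n : ℕ} {e : Fin n → Γ(M, U)}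
    (he : IsFrame M U e) (r : ℕ) :
    IsFrame (extPow r M) U (fun s : Set.powersetCard (Fin n) r =>
      wedge (fun j => e (Set.powersetCard.ofFinEmbEquiv.symm s j))) :=
  (IsPFrame.ιMulti (P := toPsh M) he r).tsh

/-- An enumeration of the `r`-element subsets of `Fin n`. -/
def subsetEquiv (n r : ℕ) : Fin (n.choose r) ≃ Set.powersetCard (Fin n) r :=
  (Fintype.equivFinOfCardEq (by
    rw [Fintype.card_eq_nat_card, Set.powersetCard.card, Nat.card_fin])).symm

/-- The increasing enumeration of the `k`-th `r`-element subset of `Fin n`. -/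
def subsetEnum (n r : ℕ) (k : Fin (n.choose r)) : Fin r → Fin n :=
  Set.powersetCard.ofFinEmbEquiv.symm (subsetEquiv n r k)

lemma IsFrame.wedge_subsetEnum {M : X.Modules} {U : X.Opens} {n : ℕ} {e : Fin n → Γ(M, U)}
    (he : IsFrame M U e) (r : ℕ) :
    IsFrame (extPow r M) U (fun k => AlgGlobGen.wedge (fun j => e (subsetEnum n r k j))) :=
  (he.wedge r).reindex (subsetEquiv n r)

lemma IsVectorBundle.extPow {n : ℕ} {E : X.Modules} (hE : IsVectorBundle n E) (r : ℕ) :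
    IsVectorBundle (n.choose r) (extPow r E) := by
  intro x
  obtain ⟨U, hx, e, he⟩ := hE x
  exact ⟨U, hx, _, he.wedge_subsetEnum r⟩

end Frames

/-! ### Morphisms of sheaves of modules, and isomorphisms tested on frames. -/

section Morphisms

variable {X Y : Scheme.{0}}

lemma app_res {M N : X.Modules} (φ : M ⟶ N) {U V : X.Opens} (h : V ≤ U) (s : Γ(M, U)) :
    φ.app V (res M h s) = res N h (φ.app U s) :=
  PresheafOfModules.naturality_apply ((Scheme.Modules.toPresheafOfModules X).map φ)
    (homOfLE h).op s

/-- A morphism of sheaves of modules given by linear maps on sections. -/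
def homMk {M N : X.Modules} (g : ∀ U : X.Opens, Γ(M, U) →ₗ[Γ(X, U)] Γ(N, U))
    (hg : ∀ (U V : X.Opens) (h : V ≤ U) (s : Γ(M, U)), g V (res M h s) = res N h (g U s)) :
    M ⟶ N :=
  Scheme.Modules.fullyFaithfulToPresheafOfModules.preimage
    { app := fun U => ModuleCat.ofHom (g U.unop)
      naturality := fun {U V} i => ModuleCat.hom_ext (LinearMap.ext fun s =>
        hg U.unop V.unop i.unop.le s) }

/-- Injectivity on every open set follows from separatedness; it then makes the local preimages
agree on overlaps, so that they glue. -/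
lemma isIso_of_locally_bijective {M N : X.Modules} (φ : M ⟶ N)
    (H : ∀ x : X, ∃ U : X.Opens, x ∈ U ∧ ∀ V ≤ U, Function.Bijective (φ.app V)) : IsIso φ := by
  choose U hU hb using H
  rw [Scheme.Modules.Hom.isIso_iff_isIso_app]
  intro V
  rw [ConcreteCategory.isIso_iff_bijective]
  have inj : ∀ V, Function.Injective (φ.app V) := by
    intro V s t hst
    refine eq_of_locally_eq M s t fun x hx => ⟨V ⊓ U x, inf_le_left, ⟨hx, hU x⟩, ?_⟩
    apply (hb x _ inf_le_right).injective
    rw [app_res, app_res, hst]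
  refine ⟨inj V, fun s => ?_⟩
  choose t ht using fun x : V => (hb x.1 (V ⊓ U x) inf_le_right).surjective
    (res N inf_le_left s)
  obtain ⟨r, hr⟩ := exists_glue M (fun x : V => V ⊓ U x) (fun x => inf_le_left)
    (fun x hx => ⟨⟨x, hx⟩, hx, hU x⟩) t (fun x y W hx hy => by
      apply inj
      rw [app_res, app_res, ht, ht, res_res, res_res])
  refine ⟨r, eq_of_locally_eq N _ _ fun x hx => ⟨V ⊓ U x, inf_le_left, ⟨hx, hU x⟩, ?_⟩⟩
  rw [← app_res, ← ht ⟨x, hx⟩]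
  exact congrArg _ (hr ⟨x, hx⟩)

lemma bijective_app_of_isFrame {M N : X.Modules} (φ : M ⟶ N) {ι : Type} [Fintype ι]
    {U : X.Opens} {e : ι → Γ(M, U)} (he : IsFrame M U e)
    (hφ : IsFrame N U (fun i => φ.app U (e i))) {V : X.Opens} (h : V ≤ U) :
    Function.Bijective (φ.app V) := by
  have : (fun c : ι → Γ(X, V) => ∑ i, c i • res N h (φ.app U (e i))) =
      φ.app V ∘ fun c : ι → Γ(X, V) => ∑ i, c i • res M h (e i) := by
    funext c
    simp only [Function.comp, map_sum, Scheme.Modules.Hom.app_smul, app_res]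
  exact ((he V h).of_comp_iff _).1 (this ▸ hφ V h)

/-- The test behind the comparison isomorphisms below: it is enough to see a local generator go to a
local generator. -/
lemma isIso_of_isNonvanishing {L N : X.Modules} (φ : L ⟶ N)
    (H : ∀ x : X, ∃ (U : X.Opens) (s : Γ(L, U)), x ∈ U ∧ IsNonvanishing L U s ∧
      IsNonvanishing N U (φ.app U s)) : IsIso φ := by
  refine isIso_of_locally_bijective φ fun x => ?_
  obtain ⟨U, s, hx, hs, hs'⟩ := H x
  exact ⟨U, hx, fun V h => bijective_app_of_isFrame φ hs hs' h⟩

lemma IsFrame.map_iso {L N : X.Modules} (φ : L ≅ N) {ι : Type} [Fintype ι]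
    {U : X.Opens} {e : ι → Γ(L, U)} (he : IsFrame L U e) :
    IsFrame N U (fun i => φ.hom.app U (e i)) := by
  intro V h
  have : (fun c : ι → Γ(X, V) => ∑ i, c i • AlgGlobGen.res N h (φ.hom.app U (e i))) =
      φ.hom.app V ∘ fun c : ι → Γ(X, V) => ∑ i, c i • AlgGlobGen.res L h (e i) := by
    funext c
    simp only [Function.comp, map_sum, Scheme.Modules.Hom.app_smul, app_res]
  rw [this]
  exact ((ConcreteCategory.isIso_iff_bijective _).1 inferInstance).comp (he V h)

lemma IsLineBundle.of_iso {L N : X.Modules} (φ : L ≅ N) (hL : IsLineBundle L) :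
    IsLineBundle N := fun x => by
  obtain ⟨U, hx, e, he⟩ := hL x
  exact ⟨U, hx, _, he.map_iso φ⟩

/-! ### Morphisms out of a tensor product -/

/-- The morphism out of the associated sheaf induced by a morphism of presheaves. -/
def sheafifyDesc {P : PModules X} {G : X.Modules} (g : P ⟶ toPsh G) : sheafify P ⟶ G :=
  (PresheafOfModules.sheafificationHomEquiv (𝟙 X.ringCatSheaf.obj)
    (F := (show SheafOfModules X.ringCatSheaf from G))).symm
    (show P ⟶ (PresheafOfModules.restrictScalars (𝟙 X.ringCatSheaf.obj)).obj (toPsh G) from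
      PresheafOfModules.homMk ((PresheafOfModules.toPresheaf _).map g)
        (fun U a m => (g.app U).hom.map_smul a m))

lemma sheafifyDesc_tsh {P : PModules X} {G : X.Modules} (g : P ⟶ toPsh G) (U : X.Opens)
    (p : P.obj (op U)) : (sheafifyDesc g).app U (tsh P U p) = g.app (op U) p :=
  congrArg (fun φ => (φ.app (op U)).hom p)
    ((PresheafOfModules.sheafificationHomEquiv (𝟙 X.ringCatSheaf.obj)
      (F := (show SheafOfModules X.ringCatSheaf from G))).apply_symm_apply _)

/-- The morphism out of a tensor product given by a natural family of bilinear maps. -/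
def tensorDesc {M N G : X.Modules}
    (b : ∀ U : X.Opens, Γ(M, U) →ₗ[Γ(X, U)] Γ(N, U) →ₗ[Γ(X, U)] Γ(G, U))
    (hb : ∀ (U V : X.Opens) (h : V ≤ U) (m : Γ(M, U)) (n : Γ(N, U)),
      b V (res M h m) (res N h n) = res G h (b U m n)) : tensor M N ⟶ G :=
  sheafifyDesc
    { app := fun U => ModuleCat.ofHom (TensorProduct.lift (b U.unop))
      naturality := fun {U V} i => ModuleCat.MonoidalCategory.tensor_ext fun m n =>
        hb U.unop V.unop i.unop.le m n }

lemma tensorDesc_tmulSection {M N G : X.Modules}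
    (b : ∀ U : X.Opens, Γ(M, U) →ₗ[Γ(X, U)] Γ(N, U) →ₗ[Γ(X, U)] Γ(G, U))
    (hb : ∀ (U V : X.Opens) (h : V ≤ U) (m : Γ(M, U)) (n : Γ(N, U)),
      b V (res M h m) (res N h n) = res G h (b U m n)) {U : X.Opens} (m : Γ(M, U)) (n : Γ(N, U)) :
    (tensorDesc b hb).app U (tmulSection m n) = b U m n :=
  (sheafifyDesc_tsh _ U _).trans (TensorProduct.lift.tmul (R := Γ(X, U)) (f' := b U) m n)

/-- A morphism, as a linear map on sections. -/
def appLin {M N : X.Modules} (φ : M ⟶ N) (U : X.Opens) : Γ(M, U) →ₗ[Γ(X, U)] Γ(N, U) where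
  toFun := φ.app U
  map_add' := map_add _
  map_smul' := φ.app_smul

/-- Tensoring a morphism with a sheaf of modules. -/
def tensorMapLeft {M M' : X.Modules} (φ : M ⟶ M') (N : X.Modules) : tensor M N ⟶ tensor M' N :=
  tensorDesc (fun U => (tmulBilin M' N U).comp (appLin φ U)) fun U V h m n => by
    change tmulSection (φ.app V _) _ = res _ h (tmulSection (φ.app U _) _)
    rw [res_tmulSection, app_res]

lemma tensorMapLeft_tmulSection {M M' : X.Modules} (φ : M ⟶ M') {N : X.Modules} {U : X.Opens}
    (m : Γ(M, U)) (n : Γ(N, U)) :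
    (tensorMapLeft φ N).app U (tmulSection m n) = tmulSection (φ.app U m) n :=
  tensorDesc_tmulSection _ _ m n

lemma tensor_congr_left {L L' N : X.Modules} (hL : IsLineBundle L) (hN : IsLineBundle N)
    (φ : L ≅ L') : Nonempty (tensor L N ≅ tensor L' N) := by
  have : IsIso (tensorMapLeft φ.hom N) := by
    refine isIso_of_isNonvanishing _ fun x => ?_
    obtain ⟨U, s, hU, hs⟩ := hL.exists_nonvanishing x
    obtain ⟨V, t, hV, ht⟩ := hN.exists_nonvanishing x
    refine ⟨U ⊓ V, _, ⟨hU, hV⟩, (hs.res inf_le_left).tmul (ht.res inf_le_right), ?_⟩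
    rw [tensorMapLeft_tmulSection]
    exact IsNonvanishing.tmul (IsFrame.map_iso φ (hs.res inf_le_left)) (ht.res inf_le_right)
  exact ⟨asIso (tensorMapLeft φ.hom N)⟩

lemma tensor_congr_right {L N N' : X.Modules} (hL : IsLineBundle L) (hN : IsLineBundle N)
    (φ : N ≅ N') : Nonempty (tensor L N ≅ tensor L N') := by
  let g : tensor L N ⟶ tensor L N' :=
    tensorDesc (fun U => (tmulBilin L N' U).compl₂ (appLin φ.hom U)) fun U V h m n => by
      change tmulSection _ (φ.hom.app V _) = res _ h (tmulSection _ (φ.hom.app U _))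
      rw [res_tmulSection, app_res]
  have : IsIso g := by
    refine isIso_of_isNonvanishing _ fun x => ?_
    obtain ⟨U, s, hU, hs⟩ := hL.exists_nonvanishing x
    obtain ⟨V, t, hV, ht⟩ := hN.exists_nonvanishing x
    refine ⟨U ⊓ V, _, ⟨hU, hV⟩, (hs.res inf_le_left).tmul (ht.res inf_le_right), ?_⟩
    rw [tensorDesc_tmulSection]
    exact IsNonvanishing.tmul (hs.res inf_le_left) (IsFrame.map_iso φ (ht.res inf_le_right))
  exact ⟨asIso g⟩

/-- The morphism `s ↦ 1 ⊗ s` sends local generators to local generators. -/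
lemma structureSheaf_tensor {L : X.Modules} (hL : IsLineBundle L) :
    Nonempty (tensor (structureSheaf X) L ≅ L) := by
  let g : L ⟶ tensor (structureSheaf X) L :=
    homMk (fun U => tmulBilin (structureSheaf X) L U (1 : Γ(X, U))) fun U V h s => by
      refine Eq.trans ?_ (res_tmulSection h _ s).symm
      exact congrArg (fun a => tmulSection (M := structureSheaf X) a (res L h s))
        (map_one (fres h)).symm
  have : IsIso g := by
    refine isIso_of_isNonvanishing _ fun x => ?_
    obtain ⟨U, s, hU, hs⟩ := hL.exists_nonvanishing x
    exact ⟨U, s, hU, hs, IsNonvanishing.tmul (isFrame_one U) hs⟩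
  exact ⟨(asIso g).symm⟩

end Morphisms

/-! ### Pulled-back sections and the universal property of the pullback. -/

section Pullback

variable {X Y : Scheme.{0}} (f : Y ⟶ X)

/-- The pullback of a section. -/
def pb (L : X.Modules) {U : X.Opens} (s : Γ(L, U)) :
    Γ((Scheme.Modules.pullback f).obj L, f ⁻¹ᵁ U) :=
  ((Scheme.Modules.pullbackPushforwardAdjunction f).unit.app L).app U s

variable {f}

lemma pb_smul {L : X.Modules} {U : X.Opens} (a : Γ(X, U)) (s : Γ(L, U)) :
    pb f L (a • s) = f.app U a • pb f L s :=
  ((Scheme.Modules.pullbackPushforwardAdjunction f).unit.app L).app_smul a s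

lemma pb_add {L : X.Modules} {U : X.Opens} (s t : Γ(L, U)) :
    pb f L (s + t) = pb f L s + pb f L t :=
  map_add (((Scheme.Modules.pullbackPushforwardAdjunction f).unit.app L).app U).hom s t

lemma pb_res {L : X.Modules} {U V : X.Opens} (h : V ≤ U) (s : Γ(L, U)) :
    pb f L (res L h s) = res _ (show f ⁻¹ᵁ V ≤ f ⁻¹ᵁ U from fun _ hx => h hx) (pb f L s) :=
  app_res ((Scheme.Modules.pullbackPushforwardAdjunction f).unit.app L) h s

/-- The morphism out of a pullback adjoint to a morphism into a pushforward. -/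
def pbDesc {L : X.Modules} {G : Y.Modules} (g : L ⟶ (Scheme.Modules.pushforward f).obj G) :
    (Scheme.Modules.pullback f).obj L ⟶ G :=
  ((Scheme.Modules.pullbackPushforwardAdjunction f).homEquiv _ _).symm g

lemma pbDesc_pb {L : X.Modules} {G : Y.Modules} (g : L ⟶ (Scheme.Modules.pushforward f).obj G)
    {U : X.Opens} (s : Γ(L, U)) : (pbDesc g).app (f ⁻¹ᵁ U) (pb f L s) = g.app U s := by
  have := ((Scheme.Modules.pullbackPushforwardAdjunction f).homEquiv _ _).apply_symm_apply g
  rw [Adjunction.homEquiv_unit] at this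
  exact congrArg (fun φ : L ⟶ (Scheme.Modules.pushforward f).obj G => φ.app U s) this

/-- By adjunction, a morphism out of a pullback is determined by its effect on pulled-back sections.
-/
lemma pb_hom_ext {L : X.Modules} {G : Y.Modules} {g h : (Scheme.Modules.pullback f).obj L ⟶ G}
    (H : ∀ (U : X.Opens) (s : Γ(L, U)),
      g.app (f ⁻¹ᵁ U) (pb f L s) = h.app (f ⁻¹ᵁ U) (pb f L s)) : g = h := by
  apply ((Scheme.Modules.pullbackPushforwardAdjunction f).homEquiv _ _).injective
  rw [Adjunction.homEquiv_unit, Adjunction.homEquiv_unit]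
  ext U s
  exact H U s

end Pullback

/-! ### Pullbacks of non-vanishing sections and of line bundles. -/

section PullbackFrame

variable {X Y : Scheme.{0}}

/-- The sheaf `V ↦ G(W ∩ V)`. -/
def extendFrom (W : Y.Opens) (G : Y.Modules) : Y.Modules :=
  (Scheme.Modules.pushforward W.ι).obj (G.restrict W.ι)

/-- The open subset `W ∩ V`, as an image under the inclusion of `W`. -/
abbrev interOpen (W V : Y.Opens) : Y.Opens := W.ι ''ᵁ (W.ι ⁻¹ᵁ V)

lemma interOpen_le_right (W V : Y.Opens) : interOpen W V ≤ V := W.ι.image_preimage_le V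

lemma interOpen_le_left (W V : Y.Opens) : interOpen W V ≤ W := by
  rintro _ ⟨x, -, rfl⟩; exact x.2

lemma le_interOpen {W V : Y.Opens} (h : V ≤ W) : V ≤ interOpen W V :=
  fun x hx => ⟨⟨x, h hx⟩, hx, rfl⟩

lemma interOpen_mono (W : Y.Opens) {V V' : Y.Opens} (h : V' ≤ V) :
    interOpen W V' ≤ interOpen W V := by
  rintro _ ⟨x, hx, rfl⟩; exact ⟨x, h hx, rfl⟩

/-- Sections of `G` over `W ∩ V`, seen as sections of `extendFrom W G` over `V`. -/
def toExtend (W : Y.Opens) (G : Y.Modules) (V : Y.Opens) (s : Γ(G, interOpen W V)) :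
    Γ(extendFrom W G, V) := s

/-- Sections of `extendFrom W G` over `V`, seen as sections of `G` over `W ∩ V`. -/
def ofExtend (W : Y.Opens) (G : Y.Modules) (V : Y.Opens) (s : Γ(extendFrom W G, V)) :
    Γ(G, interOpen W V) := s

/-- Scalars act through pullback to `W` followed by the identification of functions on an open
subset of `W` with functions on its image in `Y`; the composite is restriction. -/
lemma ofExtend_smul (W : Y.Opens) (G : Y.Modules) (V : Y.Opens) (a : Γ(Y, V))
    (s : Γ(extendFrom W G, V)) :
    ofExtend W G V (a • s) = fres (interOpen_le_right W V) a • ofExtend W G V s := by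
  change ((W.ι.appIso _).inv (W.ι.app V a)) • ofExtend W G V s = _
  congr 1
  exact congrArg (fun φ => φ.hom a) (W.ι.app_appIso_inv V)

/-- The restriction morphism `G ⟶ extendFrom W G`. -/
def toExtendHom (W : Y.Opens) (G : Y.Modules) : G ⟶ extendFrom W G :=
  (Scheme.Modules.restrictAdjunction W.ι).unit.app G

lemma ofExtend_toExtendHom (W : Y.Opens) (G : Y.Modules) (V : Y.Opens) (s : Γ(G, V)) :
    ofExtend W G V ((toExtendHom W G).app V s) = res G (interOpen_le_right W V) s := rfl

/-- Sections of `extendFrom W 𝒪_Y` over `V`, seen as functions on `W ∩ V`. -/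
def ofExtendFun (W V : Y.Opens) (s : Γ(extendFrom W (structureSheaf Y), V)) :
    Γ(Y, interOpen W V) := s

/-- Functions on `W ∩ V`, seen as sections of `extendFrom W 𝒪_Y` over `V`. -/
def toExtendFun (W V : Y.Opens) (s : Γ(Y, interOpen W V)) :
    Γ(extendFrom W (structureSheaf Y), V) := s

lemma ofExtendFun_smul (W V : Y.Opens) (a : Γ(Y, V))
    (s : Γ(extendFrom W (structureSheaf Y), V)) :
    ofExtendFun W V (a • s) = fres (interOpen_le_right W V) a * ofExtendFun W V s :=
  ofExtend_smul W (structureSheaf Y) V a s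

lemma ofExtendFun_res (W : Y.Opens) {V V' : Y.Opens} (h : V' ≤ V)
    (s : Γ(extendFrom W (structureSheaf Y), V)) :
    ofExtendFun W V' (res _ h s) = fres (interOpen_mono W h) (ofExtendFun W V s) := rfl

/-- Multiplication of functions by a section over `W`. -/
def extendSmul {W : Y.Opens} {G : Y.Modules} (s : Γ(G, W)) :
    extendFrom W (structureSheaf Y) ⟶ extendFrom W G :=
  homMk (fun V =>
    { toFun := fun c => toExtend W G V (ofExtendFun W V c • res G (interOpen_le_left W V) s)
      map_add' := fun c d => add_smul (ofExtendFun W V c) (ofExtendFun W V d)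
        (res G (interOpen_le_left W V) s)
      map_smul' := fun a c => by
        change ofExtendFun W V (a • c) • res G (interOpen_le_left W V) s =
          ofExtend W G V (a • toExtend W G V (ofExtendFun W V c • res G _ s))
        rw [ofExtendFun_smul, ofExtend_smul, mul_smul]
        rfl })
    fun V V' h c => by
      change ofExtendFun W V' (res _ h c) • res G (interOpen_le_left W V') s =
        res G (interOpen_mono W h) (ofExtendFun W V c • res G (interOpen_le_left W V) s)
      rw [res_smul, res_res, ofExtendFun_res]

lemma ofExtend_extendSmul {W : Y.Opens} {G : Y.Modules} (s : Γ(G, W)) (V : Y.Opens)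
    (c : Γ(extendFrom W (structureSheaf Y), V)) :
    ofExtend W G V ((extendSmul s).app V c) =
      ofExtendFun W V c • res G (interOpen_le_left W V) s := rfl

/-- The coefficient of a section with respect to a non-vanishing section. -/
def IsNonvanishing.coeff {L : X.Modules} {U : X.Opens} {t : Γ(L, U)} (ht : IsNonvanishing L U t)
    {V : X.Opens} (h : V ≤ U) : Γ(L, V) →ₗ[Γ(X, V)] Γ(X, V) :=
  (IsPFrame.basis (P := toPsh L) ht h).coord ()

lemma IsNonvanishing.coeff_smul {L : X.Modules} {U : X.Opens} {t : Γ(L, U)}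
    (ht : IsNonvanishing L U t) {V : X.Opens} (h : V ≤ U) (s : Γ(L, V)) :
    ht.coeff h s • AlgGlobGen.res L h t = s := by
  have := (IsPFrame.basis (P := toPsh L) ht h).sum_repr s
  rw [Finset.univ_unique, Finset.sum_singleton] at this
  exact (congrArg (ht.coeff h s • ·) (IsPFrame.basis_apply (P := toPsh L) ht h ()).symm).trans this

lemma IsNonvanishing.eq_of_smul_eq {L : X.Modules} {U : X.Opens} {t : Γ(L, U)}
    (ht : IsNonvanishing L U t) {V : X.Opens} (h : V ≤ U) {a b : Γ(X, V)}
    (hab : a • AlgGlobGen.res L h t = b • AlgGlobGen.res L h t) : a = b :=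
  congr_fun ((ht V h).injective (a₁ := fun _ => a) (a₂ := fun _ => b) (by simpa using hab)) ()

/-- Uniqueness of coefficients makes them compatible with restriction, which is what lets `pbCoeff`
be a morphism of sheaves. -/
lemma IsNonvanishing.coeff_res {L : X.Modules} {U : X.Opens} {t : Γ(L, U)}
    (ht : IsNonvanishing L U t) {V V' : X.Opens} (h : V ≤ U) (h' : V' ≤ V) (s : Γ(L, V)) :
    ht.coeff (h'.trans h) (AlgGlobGen.res L h' s) = fres h' (ht.coeff h s) := by
  apply ht.eq_of_smul_eq (h'.trans h)
  rw [coeff_smul, ← res_res L h h', ← res_smul, coeff_smul]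

variable {f : Y ⟶ X}

lemma app_fres {U V : X.Opens} (h : V ≤ U) (a : Γ(X, U)) :
    f.app V (fres h a) = fres (show f ⁻¹ᵁ V ≤ f ⁻¹ᵁ U from fun _ hx => h hx) (f.app U a) :=
  congrArg (fun φ => φ.hom a) (f.naturality (homOfLE h).op)

lemma interOpen_preimage_le (f : Y ⟶ X) (U V : X.Opens) :
    interOpen (f ⁻¹ᵁ U) (f ⁻¹ᵁ V) ≤ f ⁻¹ᵁ (U ⊓ V) :=
  le_inf (interOpen_le_left (f ⁻¹ᵁ U) (f ⁻¹ᵁ V)) (interOpen_le_right (f ⁻¹ᵁ U) (f ⁻¹ᵁ V))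

/-- The pullback of the coefficient of `s` with respect to a non-vanishing section. -/
def pbCoeffFun (f : Y ⟶ X) {L : X.Modules} {U : X.Opens} {t : Γ(L, U)}
    (ht : IsNonvanishing L U t) {V : X.Opens} (s : Γ(L, V)) :
    Γ(Y, interOpen (f ⁻¹ᵁ U) (f ⁻¹ᵁ V)) :=
  fres (interOpen_preimage_le f U V)
    (f.app (U ⊓ V) (IsNonvanishing.coeff ht inf_le_left (res L inf_le_right s)))

lemma pbCoeffFun_add {L : X.Modules} {U : X.Opens} {t : Γ(L, U)}
    (ht : IsNonvanishing L U t) {V : X.Opens} (s s' : Γ(L, V)) :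
    pbCoeffFun f ht (s + s') = pbCoeffFun f ht s + pbCoeffFun f ht s' := by
  simp only [pbCoeffFun, res_add, map_add]

lemma pbCoeffFun_smul {L : X.Modules} {U : X.Opens} {t : Γ(L, U)}
    (ht : IsNonvanishing L U t) {V : X.Opens} (a : Γ(X, V)) (s : Γ(L, V)) :
    pbCoeffFun f ht (a • s) =
      fres (interOpen_le_right (f ⁻¹ᵁ U) (f ⁻¹ᵁ V)) (f.app V a) * pbCoeffFun f ht s := by
  unfold pbCoeffFun
  rw [res_smul, map_smul, smul_eq_mul, map_mul, map_mul, app_fres, fres_fres]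

lemma pbCoeffFun_res {L : X.Modules} {U : X.Opens} {t : Γ(L, U)}
    (ht : IsNonvanishing L U t) {V V' : X.Opens} (h : V' ≤ V) (s : Γ(L, V)) :
    pbCoeffFun f ht (res L h s) = fres (interOpen_mono (f ⁻¹ᵁ U)
      (show f ⁻¹ᵁ V' ≤ f ⁻¹ᵁ V from fun _ hx => h hx)) (pbCoeffFun f ht s) := by
  have := IsNonvanishing.coeff_res ht (V := U ⊓ V) (V' := U ⊓ V') inf_le_left
    (inf_le_inf_left U h) (res L inf_le_right s)
  rw [res_res] at this
  unfold pbCoeffFun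
  rw [res_res, this, app_fres, fres_fres, fres_fres]

/-- The coefficient of a section of a pullback with respect to the pullback of a non-vanishing
section. -/
def pbCoeff (f : Y ⟶ X) {L : X.Modules} {U : X.Opens} {t : Γ(L, U)} (ht : IsNonvanishing L U t) :
    (Scheme.Modules.pullback f).obj L ⟶ extendFrom (f ⁻¹ᵁ U) (structureSheaf Y) :=
  pbDesc (homMk (fun V =>
    { toFun := fun s => toExtendFun (f ⁻¹ᵁ U) (f ⁻¹ᵁ V) (pbCoeffFun f ht s)
      map_add' := fun s s' => pbCoeffFun_add ht s s'
      map_smul' := fun a s => (pbCoeffFun_smul ht a s).trans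
        (ofExtendFun_smul (f ⁻¹ᵁ U) (f ⁻¹ᵁ V) (f.app V a) _).symm })
    fun _ _ h s => pbCoeffFun_res ht h s)

lemma pbCoeff_pb (f : Y ⟶ X) {L : X.Modules} {U : X.Opens} {t : Γ(L, U)}
    (ht : IsNonvanishing L U t) {V : X.Opens} (s : Γ(L, V)) :
    ofExtendFun (f ⁻¹ᵁ U) (f ⁻¹ᵁ V) ((pbCoeff f ht).app (f ⁻¹ᵁ V) (pb f L s)) =
      pbCoeffFun f ht s :=
  congrArg (ofExtendFun (f ⁻¹ᵁ U) (f ⁻¹ᵁ V)) (pbDesc_pb _ s)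

lemma pbCoeffFun_smul_pb {L : X.Modules} {U : X.Opens} {t : Γ(L, U)}
    (ht : IsNonvanishing L U t) {V : X.Opens} (s : Γ(L, V)) :
    pbCoeffFun f ht s • res _ (interOpen_le_left (f ⁻¹ᵁ U) (f ⁻¹ᵁ V)) (pb f L t) =
      res _ (interOpen_le_right (f ⁻¹ᵁ U) (f ⁻¹ᵁ V)) (pb f L s) := by
  have h1 := congrArg (pb f L) (IsNonvanishing.coeff_smul ht (V := U ⊓ V) inf_le_left
    (res L inf_le_right s))
  rw [pb_smul, pb_res, pb_res] at h1
  have h2 := congrArg (res _ (interOpen_preimage_le f U V)) h1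
  rwa [res_smul, res_res, res_res] at h2

lemma pbCoeffFun_self {L : X.Modules} {U : X.Opens} {t : Γ(L, U)}
    (ht : IsNonvanishing L U t) : pbCoeffFun f ht t = 1 := by
  have : IsNonvanishing.coeff ht (V := U ⊓ U) inf_le_left (res L inf_le_right t) = 1 := by
    apply IsNonvanishing.eq_of_smul_eq ht inf_le_left
    rw [IsNonvanishing.coeff_smul, one_smul]
  rw [pbCoeffFun, this, map_one, map_one]

/-- By `pb_hom_ext` only pulled-back sections need checking, and there the identity is the pullback
of `s = c • t` on `U ⊓ V`, where `c` is the coefficient of `s`. -/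
lemma pbCoeff_smul (f : Y ⟶ X) {L : X.Modules} {U : X.Opens} {t : Γ(L, U)}
    (ht : IsNonvanishing L U t) :
    pbCoeff f ht ≫ extendSmul (pb f L t) = toExtendHom (f ⁻¹ᵁ U) _ := by
  refine pb_hom_ext fun V s => ?_
  change ofExtendFun (f ⁻¹ᵁ U) (f ⁻¹ᵁ V) ((pbCoeff f ht).app (f ⁻¹ᵁ V) (pb f L s)) • res _
    (interOpen_le_left (f ⁻¹ᵁ U) (f ⁻¹ᵁ V)) (pb f L t) =
      res _ (interOpen_le_right (f ⁻¹ᵁ U) (f ⁻¹ᵁ V)) (pb f L s)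
  rw [pbCoeff_pb]
  exact pbCoeffFun_smul_pb ht s

lemma pbCoeff_app_smul {L : X.Modules} {U : X.Opens} {t : Γ(L, U)}
    (ht : IsNonvanishing L U t) {V : Y.Opens} (h : V ≤ f ⁻¹ᵁ U) (a : Γ(Y, V)) :
    ofExtendFun (f ⁻¹ᵁ U) V ((pbCoeff f ht).app V (a • res _ h (pb f L t))) =
      fres (interOpen_le_right (f ⁻¹ᵁ U) V) a := by
  rw [Scheme.Modules.Hom.app_smul, app_res, ofExtendFun_smul, ofExtendFun_res, pbCoeff_pb,
    pbCoeffFun_self, map_one, mul_one]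

/-- When `V ≤ f ⁻¹ᵁ U`, intersecting with `f ⁻¹ᵁ U` loses nothing, and `pbCoeff_smul` becomes an
identity of sections over `V`. -/
lemma smul_pb_eq {L : X.Modules} {U : X.Opens} {t : Γ(L, U)}
    (ht : IsNonvanishing L U t) {V : Y.Opens} (h : V ≤ f ⁻¹ᵁ U)
    (m : Γ((Scheme.Modules.pullback f).obj L, V)) :
    fres (le_interOpen h) (ofExtendFun (f ⁻¹ᵁ U) V ((pbCoeff f ht).app V m)) •
      res _ h (pb f L t) = m := by
  have h1 := congrArg (fun φ => ofExtend (f ⁻¹ᵁ U) _ V (φ.app V m)) (pbCoeff_smul f ht)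
  have h2 := congrArg (res _ (le_interOpen h)) h1
  change res _ (le_interOpen h) (ofExtend (f ⁻¹ᵁ U) _ V ((extendSmul (pb f L t)).app V
    ((pbCoeff f ht).app V m))) = _ at h2
  rwa [ofExtend_extendSmul, res_smul, res_res, ofExtend_toExtendHom, res_res, res_self] at h2

/-- Over opens inside `f ⁻¹ᵁ U`, the morphism `pbCoeff` is a two-sided inverse of multiplication by
the pullback of `t`: `pbCoeff_app_smul` gives injectivity and `smul_pb_eq` surjectivity. No explicit
description of the sections of the pullback is needed. -/
lemma IsNonvanishing.pb {L : X.Modules} {U : X.Opens} {t : Γ(L, U)}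
    (ht : IsNonvanishing L U t) :
    IsNonvanishing ((Scheme.Modules.pullback f).obj L) (f ⁻¹ᵁ U) (AlgGlobGen.pb f L t) := by
  intro V h
  constructor
  · intro c d hcd
    funext i
    simp only [Finset.univ_unique, Finset.sum_singleton] at hcd
    have h1 := congrArg (fun s => fres (le_interOpen h)
      (ofExtendFun (f ⁻¹ᵁ U) V ((pbCoeff f ht).app V s))) hcd
    simpa only [pbCoeff_app_smul, fres_fres, fres_self] using h1
  · intro m
    refine ⟨fun _ => fres (le_interOpen h)
      (ofExtendFun (f ⁻¹ᵁ U) V ((pbCoeff f ht).app V m)), ?_⟩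
    simp only [Finset.univ_unique, Finset.sum_singleton]
    exact smul_pb_eq ht h m

lemma IsLineBundle.pullback {L : X.Modules} (hL : IsLineBundle L) :
    IsLineBundle ((Scheme.Modules.pullback f).obj L) := by
  refine isLineBundle_of_exists fun x => ?_
  obtain ⟨U, s, hU, hs⟩ := hL.exists_nonvanishing (f x)
  exact ⟨_, _, hU, hs.pb⟩

/-- The map `(l, n) ↦ f^* l ⊗ f^* n`. -/
def pbTmul (f : Y ⟶ X) (L N : X.Modules) (U : X.Opens) :
    Γ(L, U) →ₗ[Γ(X, U)] Γ(N, U) →ₗ[Γ(X, U)] Γ((Scheme.Modules.pushforward f).obj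
      (tensor ((Scheme.Modules.pullback f).obj L) ((Scheme.Modules.pullback f).obj N)), U) :=
  LinearMap.mk₂ _ (fun l n => tmulSection (pb f L l) (pb f N n))
    (fun l l' n => by simp only [← tmulBilin_apply, pb_add, map_add, LinearMap.add_apply]; rfl)
    (fun a l n => by rw [pb_smul, smul_tmulSection]; rfl)
    (fun l n n' => by simp only [← tmulBilin_apply, pb_add, map_add]; rfl)
    (fun a l n => by rw [pb_smul, tmulSection_smul]; rfl)

/-- The comparison morphism is adjoint to `l ⊗ n ↦ f^* l ⊗ f^* n`, and it carries the pullback of a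
generator `s ⊗ t` to the generator `f^* s ⊗ f^* t`. -/
lemma pullback_tensor (f : Y ⟶ X) {L N : X.Modules} (hL : IsLineBundle L) (hN : IsLineBundle N) :
    Nonempty ((Scheme.Modules.pullback f).obj (tensor L N) ≅
      tensor ((Scheme.Modules.pullback f).obj L) ((Scheme.Modules.pullback f).obj N)) := by
  let g : tensor L N ⟶ (Scheme.Modules.pushforward f).obj
      (tensor ((Scheme.Modules.pullback f).obj L) ((Scheme.Modules.pullback f).obj N)) :=
    tensorDesc (pbTmul f L N) fun U V h l n => by
      change tmulSection (pb f L _) (pb f N _) = res _ _ (tmulSection (pb f L l) (pb f N n))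
      rw [pb_res, pb_res, ← res_tmulSection]
  have : IsIso (pbDesc g) := by
    refine isIso_of_isNonvanishing _ fun x => ?_
    obtain ⟨U, s, hU, hs⟩ := hL.exists_nonvanishing (f x)
    obtain ⟨V, t, hV, ht⟩ := hN.exists_nonvanishing (f x)
    have hs := hs.res (V := U ⊓ V) inf_le_left
    have ht := ht.res (V := U ⊓ V) inf_le_right
    refine ⟨f ⁻¹ᵁ (U ⊓ V), _, ⟨hU, hV⟩, (hs.tmul ht).pb, ?_⟩
    rw [pbDesc_pb, tensorDesc_tmulSection]
    exact hs.pb.tmul ht.pb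
  exact ⟨asIso (pbDesc g)⟩

lemma pullback_structureSheaf (f : Y ⟶ X) :
    Nonempty ((Scheme.Modules.pullback f).obj (structureSheaf X) ≅ structureSheaf Y) := by
  let g : structureSheaf X ⟶ (Scheme.Modules.pushforward f).obj (structureSheaf Y) :=
    homMk (fun U =>
      { toFun := fun a => (show Γ(Y, f ⁻¹ᵁ U) from f.app U a)
        map_add' := map_add (f.app U).hom
        map_smul' := map_mul (f.app U).hom })
      fun U V h a => app_fres h a
  have : IsIso (pbDesc g) := by
    refine isIso_of_isNonvanishing _ fun x => ?_
    refine ⟨f ⁻¹ᵁ ⊤, pb f (structureSheaf X) (1 : Γ(X, ⊤)), trivial,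
      IsNonvanishing.pb (isFrame_one ⊤), ?_⟩
    have h1 : (pbDesc g).app (f ⁻¹ᵁ ⊤) (pb f (structureSheaf X) (1 : Γ(X, ⊤))) =
        (1 : Γ(Y, f ⁻¹ᵁ ⊤)) := (pbDesc_pb g _).trans (map_one (f.app ⊤).hom)
    rw [h1]
    exact isFrame_one _
  exact ⟨asIso (pbDesc g)⟩

end PullbackFrame

/-! ### Algebraically trivial line bundles under tensor products. -/

section AlgTrivial

variable {X : Scheme.{0}} {f : X ⟶ pt}

lemma InFamily.congr_left {L L' N : X.Modules} (φ : L ≅ L') (h : InFamily f L N) :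
    InFamily f L' N := by
  obtain ⟨T, g, t₀, t₁, h₀, h₁, F, hT, hg, hq, hF, ⟨α⟩, hN⟩ := h
  exact ⟨T, g, t₀, t₁, h₀, h₁, F, hT, hg, hq, hF, ⟨α ≪≫ φ⟩, hN⟩

/-- The slice is a section of the projection to `X`, so a bundle pulled back from `X` is constant
along the family. -/
lemma pullback_slice {T : Scheme.{0}} (g : T ⟶ pt) (t : pt ⟶ T) (ht : t ≫ g = 𝟙 pt)
    (P : X.Modules) : Nonempty ((Scheme.Modules.pullback (sliceMap f g t ht)).obj
      ((Scheme.Modules.pullback (Limits.pullback.fst f g)).obj P) ≅ P) :=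
  ⟨(Scheme.Modules.pullbackComp (sliceMap f g t ht) (Limits.pullback.fst f g)).app P ≪≫
    (Scheme.Modules.pullbackCongr (Limits.pullback.lift_fst _ _ _)).app P ≪≫
    (Scheme.Modules.pullbackId X).app P⟩

lemma pullback_slice_tensor {T : Scheme.{0}} (g : T ⟶ pt) (t : pt ⟶ T) (ht : t ≫ g = 𝟙 pt)
    {F : (Limits.pullback f g).Modules} (hF : IsLineBundle F) {L P : X.Modules}
    (hP : IsLineBundle P) (α : (Scheme.Modules.pullback (sliceMap f g t ht)).obj F ≅ L) :
    Nonempty ((Scheme.Modules.pullback (sliceMap f g t ht)).obj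
      (tensor F ((Scheme.Modules.pullback (Limits.pullback.fst f g)).obj P)) ≅ tensor L P) := by
  obtain ⟨φ₁⟩ := pullback_tensor (sliceMap f g t ht) hF (hP.pullback (f := Limits.pullback.fst f g))
  obtain ⟨φ₂⟩ := tensor_congr_left hF.pullback hP.pullback.pullback α
  obtain ⟨β⟩ := pullback_slice g t ht P
  obtain ⟨φ₃⟩ := tensor_congr_right (hF.pullback.of_iso α) hP.pullback.pullback β
  exact ⟨φ₁ ≪≫ φ₂ ≪≫ φ₃⟩

/-- The family `F` is replaced by `F ⊗ pr^* P`, over the same base and with the same two points. -/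
lemma InFamily.tensor {L N P : X.Modules} (hP : IsLineBundle P) (h : InFamily f L N) :
    InFamily f (tensor L P) (tensor N P) := by
  obtain ⟨T, g, t₀, t₁, h₀, h₁, F, hT, hg, hq, hF, ⟨α⟩, ⟨β⟩⟩ := h
  exact ⟨T, g, t₀, t₁, h₀, h₁, _, hT, hg, hq, hF.tensor hP.pullback,
    pullback_slice_tensor g t₀ h₀ hF hP α, pullback_slice_tensor g t₁ h₁ hF hP β⟩

/-- Tensoring the chain from `L` to `𝒪` with `N` joins `L ⊗ N` to `𝒪 ⊗ N ≅ N`, which the second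
chain joins to `𝒪`. -/
lemma IsAlgTrivial.tensor {L N : X.Modules} (hL : IsAlgTrivial f L) (hN : IsAlgTrivial f N) :
    IsAlgTrivial f (tensor L N) := by
  refine ⟨hL.1.tensor hN.1, ?_⟩
  have h₁ : AlgEquivalent f (AlgGlobGen.tensor L N)
      (AlgGlobGen.tensor (structureSheaf X) N) :=
    Relation.TransGen.lift (fun M => AlgGlobGen.tensor M N)
      (fun _ _ h => InFamily.tensor hN.1 h) _ _ hL.2
  obtain ⟨φ⟩ := structureSheaf_tensor hN.1
  -- The isomorphism `𝒪 ⊗ N ≅ N` is absorbed by the first link of the chain, whose fibres are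
  -- prescribed only up to isomorphism.
  obtain ⟨M, hM, hMO⟩ := Relation.TransGen.head'_iff.1 hN.2
  exact h₁.trans (Relation.TransGen.head' (hM.congr_left φ.symm) hMO)

/-- A chain must have at least one link; the constant family over a point provides it. This is the
empty tensor product, needed for `r = 0`. -/
lemma isAlgTrivial_structureSheaf (f : X ⟶ pt) : IsAlgTrivial f (structureSheaf X) := by
  refine ⟨isLineBundle_structureSheaf, .single ?_⟩
  refine ⟨pt, 𝟙 pt, 𝟙 pt, 𝟙 pt, by simp, by simp, structureSheaf _, ?_, inferInstance,
    inferInstance, isLineBundle_structureSheaf, pullback_structureSheaf _,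
    pullback_structureSheaf _⟩
  change ConnectedSpace (PrimeSpectrum ℂ)
  infer_instance

/-! ### Iterated tensor products -/

/-- The tensor product of a finite family of sheaves of modules. -/
def tensorFamily : (r : ℕ) → (Fin r → X.Modules) → X.Modules
  | 0, _ => structureSheaf X
  | r + 1, L => tensor (L 0) (tensorFamily r (fun i => L i.succ))

/-- The tensor product of a finite family of sections. -/
def tensorSection {U : X.Opens} : {r : ℕ} → {L : Fin r → X.Modules} → (∀ i, Γ(L i, U)) →
    Γ(tensorFamily r L, U)
  | 0, _, _ => (1 : Γ(X, U))
  | _ + 1, _, t => tmulSection (t 0) (tensorSection fun i => t i.succ)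

lemma res_tensorSection {U V : X.Opens} (h : V ≤ U) {r : ℕ} {L : Fin r → X.Modules}
    (t : ∀ i, Γ(L i, U)) :
    res _ h (tensorSection t) = tensorSection (fun i => res (L i) h (t i)) := by
  induction r with
  | zero => exact map_one (fres h)
  | succ r ih =>
    refine (res_tmulSection h _ _).trans ?_
    rw [ih]
    rfl

lemma tensorSection_smul {U : X.Opens} {r : ℕ} {L : Fin r → X.Modules} (c : Fin r → Γ(X, U))
    (t : ∀ i, Γ(L i, U)) :
    tensorSection (fun i => c i • t i) = (∏ i, c i) • tensorSection t := by
  induction r with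
  | zero =>
    rw [Fin.prod_univ_zero, one_smul]
    rfl
  | succ r ih =>
    change tmulSection (c 0 • t 0) (tensorSection fun i => c i.succ • t i.succ) = _
    rw [ih, smul_tmulSection, tmulSection_smul, smul_smul, Fin.prod_univ_succ]
    rfl

lemma tensorSection_nonvanishing {U : X.Opens} {r : ℕ} {L : Fin r → X.Modules}
    {t : ∀ i, Γ(L i, U)} (ht : ∀ i, IsNonvanishing (L i) U (t i)) :
    IsNonvanishing (tensorFamily r L) U (tensorSection t) := by
  induction r with
  | zero => exact isFrame_one U
  | succ r ih => exact (ht 0).tmul (ih fun i => ht i.succ)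

lemma isAlgTrivial_tensorFamily {r : ℕ} {L : Fin r → X.Modules}
    (hL : ∀ i, IsAlgTrivial f (L i)) : IsAlgTrivial f (tensorFamily r L) := by
  induction r with
  | zero => exact isAlgTrivial_structureSheaf f
  | succ r ih => exact (hL 0).tensor (ih fun i => hL i.succ)

/-! ### Exterior products of twisted sections -/

/-- Tensoring with `t` turns a local frame of `E` into a local frame of `E ⊗ L` with the same
coefficients, so a quotient by `t` is unique. -/
lemma IsVectorBundle.eq_of_tmulSection_eq {n : ℕ} {E L : X.Modules} (hE : IsVectorBundle n E)
    {U : X.Opens} {t : Γ(L, U)} (ht : IsNonvanishing L U t) {a b : Γ(E, U)}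
    (h : tmulSection a t = tmulSection b t) : a = b := by
  refine eq_of_locally_eq E _ _ fun x hx => ?_
  obtain ⟨V, hV, e, he⟩ := hE x
  refine ⟨U ⊓ V, inf_le_left, ⟨hx, hV⟩, ?_⟩
  have he := he.res (V := U ⊓ V) inf_le_right
  have hfr := he.tmul_nonvanishing (ht.res (V := U ⊓ V) inf_le_left)
  obtain ⟨c, hc⟩ := he.exists_sum (res E inf_le_left a)
  obtain ⟨d, hd⟩ := he.exists_sum (res E inf_le_left b)
  have h' := congrArg (res (AlgGlobGen.tensor E L) (inf_le_left : U ⊓ V ≤ U)) h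
  rw [res_tmulSection, res_tmulSection, ← hc, ← hd, sum_tmulSection, sum_tmulSection] at h'
  simp only [smul_tmulSection] at h'
  rw [← hc, ← hd, hfr.inj h']

lemma IsVectorBundle.exists_tmulSection_eq {n : ℕ} {E L : X.Modules} (hE : IsVectorBundle n E)
    (hL : IsLineBundle L) (s : Γ(tensor E L, ⊤)) (x : X) :
    ∃ (U : X.Opens) (a : Γ(E, U)) (t : Γ(L, U)), x ∈ U ∧ IsNonvanishing L U t ∧
      tmulSection a t = res _ le_top s := by
  obtain ⟨V, hV, e, he⟩ := hE x
  obtain ⟨W, t, hW, ht⟩ := hL.exists_nonvanishing x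
  have he := he.res (V := V ⊓ W) inf_le_left
  have ht := ht.res (V := V ⊓ W) inf_le_right
  obtain ⟨c, hc⟩ := (he.tmul_nonvanishing ht).exists_sum (res _ le_top s)
  refine ⟨V ⊓ W, ∑ i, c i • res E inf_le_left (e i), _, ⟨hV, hW⟩, ht, ?_⟩
  rw [← hc, sum_tmulSection]
  simp only [smul_tmulSection]

/-- Writing `u i = c i • t i` forces `a i = c i • b i`, and the factor `∏ c i` moves across the
tensor sign. -/
lemma wedge_tmul_tensorSection_eq {n r : ℕ} {E : X.Modules} (hE : IsVectorBundle n E)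
    {L : Fin r → X.Modules} {U : X.Opens} {a b : Fin r → Γ(E, U)} {t u : ∀ i, Γ(L i, U)}
    (ht : ∀ i, IsNonvanishing (L i) U (t i))
    (h : ∀ i, tmulSection (a i) (t i) = tmulSection (b i) (u i)) :
    tmulSection (wedge a) (tensorSection t) = tmulSection (wedge b) (tensorSection u) := by
  choose c hc using fun i => IsFrame.exists_sum (ht i) (u i)
  obtain rfl : (fun i => c i () • t i) = u := by
    funext i
    rw [← hc i, Finset.univ_unique, Finset.sum_singleton]
  obtain rfl : a = fun i => c i () • b i := by
    funext i
    refine hE.eq_of_tmulSection_eq (ht i) ?_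
    rw [h i, tmulSection_smul, smul_tmulSection]
  rw [wedge_smul, tensorSection_smul, smul_tmulSection, tmulSection_smul]

/-- Sections of the twists `E ⊗ L_i` have an exterior product in `⋀^r E ⊗ L_1 ⊗ ⋯ ⊗ L_r`. -/
lemma exists_wedge_section {n r : ℕ} {E : X.Modules} (hE : IsVectorBundle n E)
    {L : Fin r → X.Modules} (hL : ∀ i, IsLineBundle (L i)) (s : ∀ i, Γ(tensor E (L i), ⊤)) :
    ∃ σ : Γ(tensor (extPow r E) (tensorFamily r L), ⊤), ∀ (U : X.Opens) (a : Fin r → Γ(E, U))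
      (t : ∀ i, Γ(L i, U)), (∀ i, IsNonvanishing (L i) U (t i)) →
      (∀ i, tmulSection (a i) (t i) = res _ le_top (s i)) →
      tmulSection (wedge a) (tensorSection t) = res _ le_top σ := by
  -- Gluing over all local factorizations at once, rather than over a chosen cover, makes the
  -- formula for `σ` hold for every factorization.
  let I := Σ U : X.Opens, {p : (Fin r → Γ(E, U)) × (∀ i, Γ(L i, U)) //
    (∀ i, IsNonvanishing (L i) U (p.2 i)) ∧
    ∀ i, tmulSection (p.1 i) (p.2 i) = res _ le_top (s i)}
  have hcov : ∀ x ∈ (⊤ : X.Opens), ∃ i : I, x ∈ i.1 := by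
    intro x _
    choose U a t hx ht h using fun i => hE.exists_tmulSection_eq (hL i) (s i) x
    refine ⟨⟨⨅ i, U i, ⟨(fun i => res E (iInf_le U i) (a i), fun i => res (L i) (iInf_le U i) (t i)),
      fun i => (ht i).res _, fun i => ?_⟩⟩, ?_⟩
    · change tmulSection (res E _ (a i)) (res (L i) _ (t i)) = _
      rw [← res_tmulSection, h, res_res]
    · exact mem_iInf_opens.2 hx
  have hcompat : ∀ (i j : I) (W : X.Opens) (hi : W ≤ i.1) (hj : W ≤ j.1),
      res (AlgGlobGen.tensor (extPow r E) (tensorFamily r L)) hi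
        (tmulSection (wedge i.2.1.1) (tensorSection i.2.1.2)) =
      res (AlgGlobGen.tensor (extPow r E) (tensorFamily r L)) hj
        (tmulSection (wedge j.2.1.1) (tensorSection j.2.1.2)) := by
    rintro ⟨U, ⟨a, t⟩, ht, h⟩ ⟨V, ⟨b, u⟩, hu, h'⟩ W hU hV
    simp only [res_tmulSection, res_wedge, res_tensorSection]
    refine wedge_tmul_tensorSection_eq hE (fun i => (ht i).res hU) fun i => ?_
    change ∀ i, tmulSection (a i) (t i) = res _ le_top (s i) at h
    change ∀ i, tmulSection (b i) (u i) = res _ le_top (s i) at h'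
    change tmulSection (res E hU (a i)) (res (L i) hU (t i)) =
      tmulSection (res E hV (b i)) (res (L i) hV (u i))
    rw [← res_tmulSection, ← res_tmulSection, h, h', res_res, res_res]
  obtain ⟨σ, hσ⟩ := exists_glue (AlgGlobGen.tensor (extPow r E) (tensorFamily r L))
    (fun i : I => i.1) (fun _ => le_top) hcov
    (fun i => tmulSection (wedge i.2.1.1) (tensorSection i.2.1.2)) hcompat
  exact ⟨σ, fun U a t ht h => (hσ ⟨U, ⟨(a, t), ht, h⟩⟩).symm⟩

end AlgTrivial

/-! ### Stalks, fibres and Nakayama's lemma. -/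

section Fibres

variable {X : Scheme.{0}}

/-- The germ of a section at a point. -/
def germ (M : X.Modules) {U : X.Opens} (x : X) (hx : x ∈ U) (s : Γ(M, U)) : Stalk M x :=
  TopCat.Presheaf.germ (toPsh M).presheaf U x hx s

lemma value_eq (M : X.Modules) {U : X.Opens} (x : X) (hx : x ∈ U) (s : Γ(M, U)) :
    value M x hx s = 1 ⊗ₜ germ M x hx s := rfl

lemma germ_res (M : X.Modules) {U V : X.Opens} (h : V ≤ U) (x : X) (hx : x ∈ V) (s : Γ(M, U)) :
    germ M x hx (res M h s) = germ M x (h hx) s :=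
  TopCat.Presheaf.germ_res_apply (toPsh M).presheaf (homOfLE h) x hx s

lemma value_res (M : X.Modules) {U V : X.Opens} (h : V ≤ U) (x : X) (hx : x ∈ V) (s : Γ(M, U)) :
    value M x hx (res M h s) = value M x (h hx) s := by
  rw [value_eq, value_eq, germ_res]

lemma germ_smul (M : X.Modules) {U : X.Opens} (x : X) (hx : x ∈ U) (a : Γ(X, U))
    (s : Γ(M, U)) : germ M x hx (a • s) = X.presheaf.germ U x hx a • germ M x hx s :=
  PresheafOfModules.germ_smul (toPsh M) x U hx a s

lemma germ_sum (M : X.Modules) {U : X.Opens} (x : X) (hx : x ∈ U) {ι : Type*} (t : Finset ι)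
    (s : ι → Γ(M, U)) : germ M x hx (∑ i ∈ t, s i) = ∑ i ∈ t, germ M x hx (s i) :=
  map_sum (TopCat.Presheaf.germ (toPsh M).presheaf U x hx).hom s t

lemma exists_germ_eq (M : X.Modules) {x : X} (m : Stalk M x) :
    ∃ (U : X.Opens) (hx : x ∈ U) (s : Γ(M, U)), germ M x hx s = m :=
  TopCat.Presheaf.exists_germ_eq (toPsh M).presheaf m

lemma exists_res_eq_of_germ_eq (M : X.Modules) {U : X.Opens} {x : X} (hx : x ∈ U)
    {s t : Γ(M, U)} (h : germ M x hx s = germ M x hx t) :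
    ∃ (V : X.Opens) (hV : V ≤ U), x ∈ V ∧ res M hV s = res M hV t := by
  obtain ⟨V, hxV, i, j, hst⟩ := TopCat.Presheaf.germ_eq (toPsh M).presheaf x hx hx s t h
  exact ⟨V, i.le, hxV, hst⟩

variable {ι : Type} [Fintype ι]

lemma IsFrame.span_germ {M : X.Modules} {U : X.Opens} {e : ι → Γ(M, U)} (he : IsFrame M U e)
    {x : X} (hx : x ∈ U) :
    Submodule.span (X.presheaf.stalk x) (Set.range fun i => germ M x hx (e i)) = ⊤ := by
  refine eq_top_iff.2 fun m _ => ?_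
  obtain ⟨V, hxV, s, rfl⟩ := exists_germ_eq M m
  have hxW : x ∈ U ⊓ V := ⟨hx, hxV⟩
  obtain ⟨c, hc⟩ := (he.res (V := U ⊓ V) inf_le_left).exists_sum
    (AlgGlobGen.res M inf_le_right s)
  rw [← germ_res M (inf_le_right : U ⊓ V ≤ V) x hxW, ← hc, germ_sum]
  refine Submodule.sum_mem _ fun i _ => ?_
  rw [germ_smul, germ_res]
  exact Submodule.smul_mem _ _ (Submodule.subset_span ⟨i, rfl⟩)

lemma IsVectorBundle.finite_stalk {n : ℕ} {M : X.Modules} (hM : IsVectorBundle n M) (x : X) :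
    Module.Finite (X.presheaf.stalk x) (Stalk M x) := by
  obtain ⟨U, hx, e, he⟩ := hM x
  exact ⟨Submodule.fg_def.2 ⟨_, Set.finite_range _, he.span_germ hx⟩⟩

/-- Nakayama's lemma for the stalk, which is finitely generated because `M` is a vector bundle. -/
lemma span_value_eq_top_iff {n : ℕ} {M : X.Modules} (hM : IsVectorBundle n M) {U : X.Opens}
    {x : X} (hx : x ∈ U) {κ : Type*} (a : κ → Γ(M, U)) :
    Submodule.span (IsLocalRing.ResidueField (X.presheaf.stalk x))
        (Set.range fun i => value M x hx (a i)) = ⊤ ↔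
      Submodule.span (X.presheaf.stalk x) (Set.range fun i => germ M x hx (a i)) = ⊤ := by
  have := hM.finite_stalk x
  have h := IsLocalRing.map_tensorProduct_mk_eq_top (R := X.presheaf.stalk x)
    (N := Submodule.span (X.presheaf.stalk x) (Set.range fun i => germ M x hx (a i)))
  -- The local ring surjects onto its residue field, so spans over the two rings have the same
  -- elements.
  rw [Submodule.map_span, ← Submodule.restrictScalars_span (X.presheaf.stalk x)
      (IsLocalRing.ResidueField (X.presheaf.stalk x)) Ideal.Quotient.mk_surjective,
    Submodule.restrictScalars_eq_top_iff, ← Set.range_comp] at h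
  exact h

/-- A linear relation in the stalk involves finitely many coefficients and one equality of germs,
all of which spread to a neighbourhood. -/
lemma exists_res_mem_span_of_germ_mem_span {M : X.Modules} {U : X.Opens} {x : X} (hx : x ∈ U)
    {a : ι → Γ(M, U)} {s : Γ(M, U)}
    (h : germ M x hx s ∈ Submodule.span (X.presheaf.stalk x)
      (Set.range fun i => germ M x hx (a i))) :
    ∃ (V : X.Opens) (hV : V ≤ U), x ∈ V ∧
      res M hV s ∈ Submodule.span Γ(X, V) (Set.range fun i => res M hV (a i)) := by
  obtain ⟨c, hc⟩ := Submodule.mem_span_range_iff_exists_fun _ |>.1 h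
  choose W hW C hC using fun i => X.presheaf.exists_germ_eq (c i)
  let V₀ : X.Opens := U ⊓ ⨅ i, W i
  have hV₀ : ∀ i, V₀ ≤ W i := fun i => inf_le_right.trans (iInf_le W i)
  have hx₀ : x ∈ V₀ := ⟨hx, mem_iInf_opens.2 hW⟩
  have key : germ M x hx₀ (res M inf_le_left s) =
      germ M x hx₀ (∑ i, fres (hV₀ i) (C i) • res M inf_le_left (a i)) := by
    rw [germ_sum, germ_res, ← hc]
    refine Finset.sum_congr rfl fun i _ => ?_
    rw [germ_smul, germ_res, ← hC i]
    congr 1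
    exact (TopCat.Presheaf.germ_res_apply X.presheaf (homOfLE (hV₀ i)) x hx₀ (C i)).symm
  obtain ⟨V, hV, hxV, H⟩ := exists_res_eq_of_germ_eq M hx₀ key
  refine ⟨V, hV.trans inf_le_left, hxV, ?_⟩
  rw [← res_res M inf_le_left hV, H, res_sum]
  refine Submodule.sum_mem _ fun i _ => ?_
  rw [res_smul, res_res]
  exact Submodule.smul_mem _ _ (Submodule.subset_span ⟨i, rfl⟩)

lemma res_mem_span {M : X.Modules} {U V : X.Opens} (h : V ≤ U) {a : ι → Γ(M, U)} {s : Γ(M, U)}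
    (hs : s ∈ Submodule.span Γ(X, U) (Set.range a)) :
    res M h s ∈ Submodule.span Γ(X, V) (Set.range fun i => res M h (a i)) := by
  obtain ⟨c, rfl⟩ := Submodule.mem_span_range_iff_exists_fun _ |>.1 hs
  rw [res_sum]
  refine Submodule.sum_mem _ fun i _ => ?_
  rw [res_smul]
  exact Submodule.smul_mem _ _ (Submodule.subset_span ⟨i, rfl⟩)

/-- Over each smaller open the `a i` generate a free module having a basis with the same index set,
and a surjective endomorphism of a finite module is injective. -/
lemma IsFrame.of_mem_span {M : X.Modules} {U : X.Opens} {e a : ι → Γ(M, U)}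
    (he : IsFrame M U e) (h : ∀ i, e i ∈ Submodule.span Γ(X, U) (Set.range a)) :
    IsFrame M U a := by
  intro V hV
  let b : Module.Basis ι Γ(X, V) Γ(M, V) := IsPFrame.basis (P := toPsh M) he hV
  have hb : ∀ i, b i = AlgGlobGen.res M hV (e i) := IsPFrame.basis_apply (P := toPsh M) he hV
  let φ := Fintype.linearCombination Γ(X, V) (fun i => AlgGlobGen.res M hV (a i))
  have hφ : Function.Surjective φ := by
    rw [← LinearMap.range_eq_top, Fintype.range_linearCombination, eq_top_iff, ← b.span_eq,
      Submodule.span_le]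
    rintro _ ⟨i, rfl⟩
    rw [hb]
    exact res_mem_span hV (h i)
  have hinj := OrzechProperty.injective_of_surjective_endomorphism
    (b.equivFun.toLinearMap.comp φ) (b.equivFun.surjective.comp hφ)
  exact ⟨Function.Injective.of_comp hinj, hφ⟩

/-- By Nakayama the germs of the `a i` generate the stalk. Near `x` they therefore generate a
reference frame `e` with the same number of members, and `IsFrame.of_mem_span` applies. -/
lemma IsVectorBundle.exists_isFrame {n : ℕ} {M : X.Modules} (hM : IsVectorBundle n M)
    {U : X.Opens} {x : X} (hx : x ∈ U) {a : Fin n → Γ(M, U)}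
    (h : Submodule.span (IsLocalRing.ResidueField (X.presheaf.stalk x))
        (Set.range fun i => value M x hx (a i)) = ⊤) :
    ∃ (V : X.Opens) (hV : V ≤ U), x ∈ V ∧ IsFrame M V (fun i => res M hV (a i)) := by
  rw [span_value_eq_top_iff hM hx] at h
  obtain ⟨W, hxW, e, he⟩ := hM x
  have hx₀ : x ∈ U ⊓ W := ⟨hx, hxW⟩
  have H : ∀ j, ∃ (V : X.Opens) (hV : V ≤ U ⊓ W), x ∈ V ∧
      res M hV (res M inf_le_right (e j)) ∈ Submodule.span Γ(X, V)
        (Set.range fun i => res M hV (res M inf_le_left (a i))) := fun j => by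
    apply exists_res_mem_span_of_germ_mem_span hx₀
    simp only [germ_res]
    rw [h]
    trivial
  choose V hV hxV H using H
  let V₀ : X.Opens := (U ⊓ W) ⊓ ⨅ i, V i
  have hV₀ : ∀ i, V₀ ≤ V i := fun i => inf_le_right.trans (iInf_le V i)
  refine ⟨V₀, inf_le_left.trans inf_le_left, ⟨hx₀, mem_iInf_opens.2 hxV⟩, ?_⟩
  refine IsFrame.of_mem_span (he.res (V := V₀) (inf_le_left.trans inf_le_right)) fun j => ?_
  simpa only [res_res] using res_mem_span (hV₀ j) (H j)

lemma IsFrame.span_value {M : X.Modules} {n : ℕ} (hM : IsVectorBundle n M) {U : X.Opens}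
    {e : ι → Γ(M, U)} (he : IsFrame M U e) {x : X} (hx : x ∈ U) :
    Submodule.span (IsLocalRing.ResidueField (X.presheaf.stalk x))
      (Set.range fun i => value M x hx (e i)) = ⊤ :=
  (span_value_eq_top_iff hM hx e).2 (he.span_germ hx)

/-- A zero value would make the fibre zero, hence the stalk by Nakayama. Then `s` is zero near `x`,
so `1 = 0` on a neighbourhood, contradicting nontriviality of the local ring at `x`. -/
lemma IsNonvanishing.value_ne_zero {L : X.Modules} (hL : IsLineBundle L) {U : X.Opens}
    {s : Γ(L, U)} (hs : IsNonvanishing L U s) {x : X} (hx : x ∈ U) : value L x hx s ≠ 0 := by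
  intro h
  have hspan := IsFrame.span_value hL hs hx
  have := IsVectorBundle.finite_stalk hL x
  have hsub : Subsingleton (Fibre L x) := by
    rw [← Submodule.subsingleton_iff (IsLocalRing.ResidueField (X.presheaf.stalk x)),
      ← subsingleton_iff_bot_eq_top, ← hspan, h, eq_comm, Submodule.span_eq_bot]
    rintro _ ⟨_, rfl⟩
    rfl
  rw [IsLocalRing.subsingleton_tensorProduct] at hsub
  obtain ⟨V, hV, hxV, H⟩ := exists_res_eq_of_germ_eq L hx
    (Subsingleton.elim (germ L x hx s) (germ L x hx 0))
  have h10 : (1 : Γ(X, V)) = 0 := by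
    apply eq_of_smul_eq hs hV
    rw [H, res_zero, smul_zero, smul_zero]
  have := congrArg (X.presheaf.germ V x hxV).hom h10
  rw [map_one, map_zero] at this
  exact one_ne_zero this

end Fibres

/-! ### Exterior powers and the para-canonical base locus. -/

section Main

variable {X : Scheme.{0}} {f : X ⟶ pt}

/-- Exterior powers of algebraically globally generated vector bundles are algebraically globally
generated. -/
lemma IsAlgGloballyGenerated.extPow {n : ℕ} {E : X.Modules} (hE : IsAlgGloballyGenerated f n E)
    (r : ℕ) : IsAlgGloballyGenerated f (n.choose r) (extPow r E) := by
  refine ⟨hE.1.extPow r, fun x hxc => ?_⟩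
  obtain ⟨L, s, hL, U, hx, s', e, hs', hes, hspan⟩ := hE.2 x hxc
  choose σ hσ using fun k => exists_wedge_section hE.1
    (L := fun j => L (subsetEnum n r k j)) (fun j => (hL _).1) (fun j => s (subsetEnum n r k j))
  refine ⟨fun k => tensorFamily r (fun j => L (subsetEnum n r k j)), σ,
    fun k => isAlgTrivial_tensorFamily fun j => hL _, U, hx,
    fun k => tensorSection fun j => s' (subsetEnum n r k j),
    fun k => wedge fun j => e (subsetEnum n r k j),
    fun k => tensorSection_nonvanishing fun j => hs' _,
    fun k => hσ k U _ _ (fun j => hs' _) (fun j => hes _), ?_⟩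
  -- Passing from generators of the fibre to a frame on `V` makes the wedges a frame too, and values
  -- at `x` do not change under restriction.
  obtain ⟨V, hV, hxV, he⟩ := hE.1.exists_isFrame hx hspan
  have := (he.wedge_subsetEnum r).span_value (hE.1.extPow r) hxV
  simpa only [← res_wedge, value_res] using this

/-- Given any point `x`, a closed point `y` in its closure has a twist of `D` with a section
non-vanishing on a neighbourhood of `y`. That neighbourhood contains `x`, so `x` is outside the base
locus of this twist. -/
lemma IsAlgGloballyGenerated.paraBaseLocus_eq_empty [JacobsonSpace X] {D : X.Modules}
    (hD : IsAlgGloballyGenerated f 1 D) : paraBaseLocus f D = ∅ := by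
  refine Set.eq_empty_of_forall_notMem fun x hx => ?_
  obtain ⟨y, hy, hyc⟩ := nonempty_inter_closedPoints (Z := closure {x})
    ⟨x, subset_closure rfl⟩ isClosed_closure.isLocallyClosed
  obtain ⟨L, s, hL, U, hyU, s', e, hs', hes, hspan⟩ := hD.2 y hyc
  obtain ⟨V, hV, hyV, he⟩ := hD.1.exists_isFrame hyU hspan
  have hxV : x ∈ V := by
    obtain ⟨z, hz, rfl⟩ := mem_closure_iff.1 hy V V.isOpen hyV
    exact hz
  have hnv : IsNonvanishing (tensor D (L 0)) V (res _ le_top (s 0)) := by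
    have h1 : IsNonvanishing D V (res D hV (e 0)) := he.reindex (Equiv.ofUnique Unit (Fin 1))
    have h2 := h1.tmul ((hs' 0).res hV)
    rwa [← res_tmulSection, hes, res_res] at h2
  have hline : IsLineBundle (tensor D (L 0)) := IsLineBundle.tensor hD.1 (hL 0).1
  apply hnv.value_ne_zero hline hxV
  rw [value_res]
  exact hx (L 0) (hL 0) (s 0)

/-- A smooth morphism is locally of finite type, and the Jacobson property passes up such morphisms
from `Spec ℂ`. -/
lemma IsSmoothProjectiveVariety.jacobsonSpace (hX : IsSmoothProjectiveVariety f) :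
    JacobsonSpace X := by
  have := hX.smooth
  exact LocallyOfFiniteType.jacobsonSpace f

end Main
end AlgGlobGen

end

theorem corollary3p5 (X : Scheme.{0}) (f : X ⟶ Spec (.of ℂ))
    (hX : AlgGlobGen.IsSmoothProjectiveVariety f) (n : ℕ) (E : X.Modules)
    (hE : AlgGlobGen.IsAlgGloballyGenerated f n E) :
    (∀ r : ℕ, AlgGlobGen.IsAlgGloballyGenerated f (n.choose r) (AlgGlobGen.extPow r E)) ∧
      AlgGlobGen.paraBaseLocus f (AlgGlobGen.det n E) = ∅ := by
  have := hX.jacobsonSpace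
  refine ⟨fun r => hE.extPow r, AlgGlobGen.IsAlgGloballyGenerated.paraBaseLocus_eq_empty ?_⟩
  simpa only [Nat.choose_self] using hE.extPow n
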